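/- Let $\mathbb K$ be a field of characteristic zero, $A$ a commutative associative $\mathbb K$-algebra with identity which is an integral domain, and $R$ its field of fractions. Derivations of $A$ are extended to $R$, and $W(A)=R\,\mathrm{Der}_{\mathbb K}A\subseteq \mathrm{Der}_{\mathbb K}R$ is the Lie algebra over $\mathbb K$ consisting of all $R$-linear combinations of such extensions. The rank of a subalgebra $L\subseteq W(A)$ over $R$ is $\dim_R RL$, and its field of constants is $F=F(L)=\{r\in R: D(r)=0 \text{ for all } D\in L\}$. We write $L=B\rightthreetimes N$ if $L=B+N$, $B\cap N=0$, $B$ is a subalgebra and $N$ is an ideal of $L$. The general affine Lie algebra is $ga_2(F)=gl_2(F)\rightthreetimes F^2$, and $\langle\,\cdot\,\rangle$ denotes the $F$-linear span. Let $L$ be a solvable subalgebra of $W(A)$ which is maximal (by inclusion) among all solvable subalgebras of rank $2$ over $R$ of $W(A)$. Then $L$ is a Lie algebra over $F$ (that is, $FL=L$), and $L$ contains elements $D_1,D_2$, linearly independent over $R$, such that, with $F_1=\ker D_1\subseteq R$, one has $[D_2,D_1]=aD_1$ for some $a\in F_1$ and $L$ is one of the following algebras over $F$: 1. $L=\langle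 D_2\rangle\rightthreetimes F_1D_1$. 2. $L=\langle D_2\rangle\rightthreetimes(F_1D_1+bF_1D_1)$, where $b\in R$, $D_1(b)=1$, and $D_2(b)=ab+a_1$ for some $a_1\in F_1$. 3. $L=(\langle cD_1+dD_2\rangle\rightthreetimes\langle D_2\rangle)\rightthreetimes F_1D_1$, where $c\in R$, $d\in F_1$, $D_1(c)\in F_1$, $D_2(d)=1$, and $D_2(c)=-ac+r$ for some $r\in F_1$. 4. $L=(\langle cD_1+dD_2\rangle\rightthreetimes\langle D_2\rangle)\rightthreetimes(F_1D_1+F_1bD_1)$, where $b,c\in R$, $d\in F_1$, $D_1(b)=1$, $D_2(d)=1$, $D_1(c)\in F_1$, and $D_2(c)=ac+r$, $D_2(b)=ab+a_1$ for some $r,a_1\in F_1$. 5. $L$ is isomorphic, as a Lie algebra over $F$, to a solvable subalgebra of $ga_2(F)$ containing $F^2$; in particular $2\le\dim_F L\le 5$. -/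

import Mathlib

/-- The Lie algebra `W(A) = R Der A`, where `R` is the quotient field of `A`: the `R`-linear span,
inside `Der_K R`, of the (unique) extensions to `R` of the `K`-derivations of `A`. -/
def derivationsW (K A R : Type*) [Field K] [CommRing A] [Algebra K A] [Field R] [Algebra A R]
    [Algebra K R] : LieSubalgebra K (Derivation K R R) where
  __ := (Submodule.span R {D : Derivation K R R | ∃ δ : Derivation K A A,
    ∀ x : A, D (algebraMap A R x) = algebraMap A R (δ x)}).restrictScalars K
  lie_mem' := by
    intro x y hx hy
    change x ∈ Submodule.span R _ at hx
    change y ∈ Submodule.span R _ at hy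
    change ⁅x, y⁆ ∈ Submodule.span R _
    have key : ∀ (r s : R) (D E : Derivation K R R),
        ⁅r • D, s • E⁆ = (r * s) • ⁅D, E⁆ + (r * D s) • E - (s * E r) • D := by
      intro r s D E
      ext z
      simp [Derivation.commutator_apply]
      ring
    induction hx using Submodule.closure_induction with
    | zero => simp
    | add a b _ _ ha hb => rw [add_lie]; exact add_mem ha hb
    | smul_mem r D hD =>
      induction hy using Submodule.closure_induction with
      | zero => simp
      | add a b _ _ ha hb => rw [lie_add]; exact add_mem ha hb
      | smul_mem s E hE =>
        rw [key]
        refine sub_mem (add_mem (Submodule.smul_mem _ _ (Submodule.subset_span ?_))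
          (Submodule.smul_mem _ _ (Submodule.subset_span hE)))
          (Submodule.smul_mem _ _ (Submodule.subset_span hD))
        obtain ⟨δ, hδ⟩ := hD
        obtain ⟨ε, hε⟩ := hE
        exact ⟨⁅δ, ε⁆, fun z => by simp [Derivation.commutator_apply, hδ, hε]⟩

/-- The rank over `R` of a Lie algebra `L` of derivations of `R`: the dimension of `R L`
(equal to `0` if that dimension is infinite). -/
noncomputable def derivationRank {K R : Type*} [Field K] [Field R] [Algebra K R]
    (L : LieSubalgebra K (Derivation K R R)) : ℕ :=
  Module.finrank R (Submodule.span R (L : Set (Derivation K R R)))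

/-- The field of constants `F(L) = {r ∈ R | D r = 0 for all D ∈ L}`. -/
def constantField {K R : Type*} [Field K] [Field R] [Algebra K R]
    (L : LieSubalgebra K (Derivation K R R)) : IntermediateField K R where
  carrier := {r | ∀ D ∈ L, D r = 0}
  mul_mem' := fun {x y} hx hy D hD => by simp [hx D hD, hy D hD]
  add_mem' := fun {x y} hx hy D hD => by simp [hx D hD, hy D hD]
  algebraMap_mem' := fun r D _ => by simp
  inv_mem' := fun x hx D hD => by simp [Derivation.leibniz_inv, hx D hD]

section overF

variable {F R : Type*} [Field F] [Field R] [Algebra F R]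

/-- For a derivation `D` of `R` and `b ∈ R`, the `F`-space `b (ker D) D = {(f b) D | D f = 0}`.
For `b = 1` this is `F₁ D` with `F₁ = ker D`. -/
def kerMultiples (D : Derivation F R R) (b : R) : Submodule F (Derivation F R R) where
  carrier := {E | ∃ f : R, D f = 0 ∧ E = (f * b) • D}
  add_mem' := by
    rintro _ _ ⟨f, hf, rfl⟩ ⟨g, hg, rfl⟩
    exact ⟨f + g, by simp [hf, hg], by rw [add_mul, add_smul]⟩
  zero_mem' := ⟨0, by simp, by simp⟩
  smul_mem' := by
    rintro t _ ⟨f, hf, rfl⟩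
    exact ⟨t • f, by simp [hf], by rw [smul_mul_assoc, smul_assoc]⟩

/-- `L` is the (internal) semidirect sum of the subalgebra `B` and the ideal `N`. -/
structure IsSemidirectSum {M : Type*} [LieRing M] [LieAlgebra F M] (L B N : Submodule F M) :
    Prop where
  lie_mem_subalgebra : ∀ x ∈ B, ∀ y ∈ B, ⁅x, y⁆ ∈ B
  lie_mem_ideal : ∀ x ∈ L, ∀ y ∈ N, ⁅x, y⁆ ∈ N
  sup_eq : B ⊔ N = L
  inf_eq : B ⊓ N = ⊥

/-- `L = ⟨D₂⟩ ⋋ F₁ D₁`. -/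
def IsType1 (L : LieSubalgebra F (Derivation F R R)) (D₁ D₂ : Derivation F R R) : Prop :=
  IsSemidirectSum L.toSubmodule (Submodule.span F {D₂}) (kerMultiples D₁ 1)

/-- `L = ⟨D₂⟩ ⋋ (F₁ D₁ + b F₁ D₁)`. -/
def IsType2 (L : LieSubalgebra F (Derivation F R R)) (D₁ D₂ : Derivation F R R) (a : R) : Prop :=
  ∃ b a₁ : R, D₁ b = 1 ∧ D₁ a₁ = 0 ∧ D₂ b = a * b + a₁ ∧
    IsSemidirectSum L.toSubmodule (Submodule.span F {D₂})
      (kerMultiples D₁ 1 ⊔ kerMultiples D₁ b)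

/-- `L` is the semidirect sum of the ideal `F₁ D₁` and a subalgebra `B`, which is itself the
semidirect sum of its one-dimensional subspaces `⟨D₂⟩` (the ideal) and `⟨c D₁ + d D₂⟩`. -/
def IsType3 (L : LieSubalgebra F (Derivation F R R)) (D₁ D₂ : Derivation F R R) (a : R) : Prop :=
  ∃ c d r : R, D₁ d = 0 ∧ D₁ (D₁ c) = 0 ∧ D₂ d = 1 ∧ D₁ r = 0 ∧ D₂ c = -(a * c) + r ∧
    ∃ B : Submodule F (Derivation F R R),
      IsSemidirectSum B (Submodule.span F {c • D₁ + d • D₂}) (Submodule.span F {D₂}) ∧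
      IsSemidirectSum L.toSubmodule B (kerMultiples D₁ 1)

/-- `L` is the semidirect sum of the ideal `F₁ D₁ + F₁ b D₁` and a subalgebra `B`, which is itself
the semidirect sum of its one-dimensional subspaces `⟨D₂⟩` (the ideal) and `⟨c D₁ + d D₂⟩`. -/
def IsType4 (L : LieSubalgebra F (Derivation F R R)) (D₁ D₂ : Derivation F R R) (a : R) : Prop :=
  ∃ b c d r a₁ : R, D₁ b = 1 ∧ D₂ d = 1 ∧ D₁ d = 0 ∧ D₁ (D₁ c) = 0 ∧ D₁ r = 0 ∧ D₁ a₁ = 0 ∧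
    D₂ c = a * c + r ∧ D₂ b = a * b + a₁ ∧
    ∃ B : Submodule F (Derivation F R R),
      IsSemidirectSum B (Submodule.span F {c • D₁ + d • D₂}) (Submodule.span F {D₂}) ∧
      IsSemidirectSum L.toSubmodule B (kerMultiples D₁ 1 ⊔ kerMultiples D₁ b)

section affine

attribute [local instance] LieRing.ofAssociativeRing

/-- The general affine Lie algebra `ga₂(F) = gl₂(F) ⋋ F²`, realized as the `3 × 3` matrices with
zero last row. -/
def affineLieAlgebra (F : Type*) [Field F] : LieSubalgebra F (Matrix (Fin 3) (Fin 3) F) where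
  carrier := {M | ∀ j, M 2 j = 0}
  add_mem' := fun {M N} hM hN j => by simp [hM j, hN j]
  zero_mem' := fun j => by simp
  smul_mem' := fun t M hM j => by simp [hM j]
  lie_mem' := fun {M N} hM hN j => by
    rw [Ring.lie_def, Matrix.sub_apply, Matrix.mul_apply, Matrix.mul_apply]
    simp only [hM _, hN _, zero_mul, Finset.sum_const_zero, sub_zero]

/-- The ideal `F²` of translations in `ga₂(F)`: the matrices whose only nonzero entries are the
first two entries of the last column. -/
def translations (F : Type*) [Field F] : Set (Matrix (Fin 3) (Fin 3) F) :=
  {M | (∀ j, M 2 j = 0) ∧ ∀ i j, j ≠ 2 → M i j = 0}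

/-- `L` is isomorphic to a solvable subalgebra of `ga₂(F)` containing `F²`, and
`2 ≤ dim_F L ≤ 5`. -/
def IsType5 (L : LieSubalgebra F (Derivation F R R)) : Prop :=
  (∃ S : LieSubalgebra F (Matrix (Fin 3) (Fin 3) F), S ≤ affineLieAlgebra F ∧
    LieAlgebra.IsSolvable S ∧ translations F ⊆ (S : Set (Matrix (Fin 3) (Fin 3) F)) ∧
    Nonempty (L ≃ₗ⁅F⁆ S)) ∧
  2 ≤ Module.finrank F L ∧ Module.finrank F L ≤ 5

end affine

end overF

/-! The `F`-span of `L` is solvable with the same `R`-span, so maximality gives `FL = L`, and `L`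
becomes an algebra of `F`-derivations with constants exactly `F`. The same principle drives the
rest: a solvable subspace of `RL` that is closed under brackets and normalized by `L` already lies
in `L` (`le_of_normalized`).

Let `I` be a nonzero abelian ideal and `0 ≠ D₁ ∈ I`. If `I ⊆ R D₁`, then `[x, D₁] = f D₁` commutes
with `D₁`, so `D₁ f = 0` and `L` normalizes `F₁ D₁`. Absorption gives `F₁ D₁ ⊆ L`, and `L ∩ R D₁` is
`F₁ D₁` or `F₁ D₁ + F₁ b D₁` (`smul_mem_dichotomy`). Modulo `R D₁`, solvability provides `D₂` such
that every `u D₁ + v D₂ ∈ L` has `D₁ v = 0` and `D₂ v ∈ F` (`exists_complement`). Hence `v` lies in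
`F`, or in `F + F d` with `D₂ d = 1`; the two alternatives twice give types 1–4 after a change of
`D₂`.

Otherwise `I` contains commuting `D₁, D₂` independent over `R`, and elements of `I` have
coefficients in `F`. Since `[x, Dᵢ] ∈ I`, the coefficients of every `x ∈ L` have derivatives in `F`:
they are affine functions, so `L` embeds in `ga₂(F)` (`isType5_of_affine`). The bound 5 holds
because `ga₂(F)`, of dimension 6, contains `sl₂`. -/

/-! ### Solvability of additive subgroups, independent of the scalars -/

/-- `X` lies in a chain `X = X₀, X₁, …, Xₙ = 0` of additive subgroups of a Lie ring with
`⁅Xᵢ, Xᵢ⁆ ⊆ Xᵢ₊₁`. -/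
inductive BracketSolvable {M : Type*} [LieRing M] : AddSubgroup M → Prop
  | bot : BracketSolvable ⊥
  | step (X Y : AddSubgroup M) (hY : BracketSolvable Y)
      (hXY : ∀ x ∈ X, ∀ y ∈ X, ⁅x, y⁆ ∈ Y) : BracketSolvable X

namespace BracketSolvable

variable {M M' : Type*} [LieRing M] [LieRing M']

theorem mono {X Y : AddSubgroup M} (hY : BracketSolvable Y) (h : X ≤ Y) : BracketSolvable X := by
  cases hY with
  | bot => exact (le_bot_iff.mp h) ▸ bot
  | step _ Z hZ hYZ => exact step X Z hZ fun x hx y hy => hYZ x (h hx) y (h hy)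

theorem of_abelian {X : AddSubgroup M} (h : ∀ x ∈ X, ∀ y ∈ X, ⁅x, y⁆ = 0) :
    BracketSolvable X :=
  step X ⊥ bot fun x hx y hy => by simp [h x hx y hy]

theorem map {X : AddSubgroup M} (hX : BracketSolvable X) (φ : M →+ M')
    (hφ : ∀ x y, φ ⁅x, y⁆ = ⁅φ x, φ y⁆) : BracketSolvable (X.map φ) := by
  induction hX with
  | bot => rw [AddSubgroup.map_bot]; exact bot
  | step X Y _ hXY ih =>
    refine step _ _ ih ?_
    rintro _ ⟨x, hx, rfl⟩ _ ⟨y, hy, rfl⟩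
    exact ⟨⁅x, y⁆, hXY x hx y hy, hφ x y⟩

theorem comap {X : AddSubgroup M'} (hX : BracketSolvable X) (φ : M →+ M')
    (hφ : ∀ x y, φ ⁅x, y⁆ = ⁅φ x, φ y⁆) (hinj : Function.Injective φ) :
    BracketSolvable (X.comap φ) := by
  induction hX with
  | bot =>
    refine mono bot fun x hx => ?_
    have hx' : φ x = 0 := hx
    exact hinj (hx'.trans (map_zero φ).symm)
  | step X Y _ hXY ih =>
    refine step _ _ ih fun x hx y hy => ?_
    change φ ⁅x, y⁆ ∈ Y
    rw [hφ]
    exact hXY _ hx _ hy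

/-- Adding an ideal `N` that is solvable to a solvable subalgebra `L` that normalizes it. -/
theorem sup {L N : AddSubgroup M} (hL : BracketSolvable L) (hN : BracketSolvable N)
    (hLL : ∀ x ∈ L, ∀ y ∈ L, ⁅x, y⁆ ∈ L)
    (hLN : ∀ x ∈ L, ∀ y ∈ N, ⁅x, y⁆ ∈ N) (hNN : ∀ x ∈ N, ∀ y ∈ N, ⁅x, y⁆ ∈ N) :
    BracketSolvable (L ⊔ N) := by
  suffices h : BracketSolvable ((L ⊓ L) ⊔ N) by rwa [inf_idem] at h
  -- Terms of the chain need not lie in `L`, where `N` is normalized; hence the intersection with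
  -- `L` at each stage.
  have key : ∀ X : AddSubgroup M, BracketSolvable X → BracketSolvable ((X ⊓ L) ⊔ N) := by
    intro X hX
    induction hX with
    | bot => simpa using hN
    | step X Y _ hXY ih =>
      refine step _ _ ih ?_
      intro x hx y hy
      obtain ⟨l, ⟨hlX, hlL⟩, n, hn, rfl⟩ := AddSubgroup.mem_sup.mp hx
      obtain ⟨l', ⟨hlX', hlL'⟩, n', hn', rfl⟩ := AddSubgroup.mem_sup.mp hy
      refine AddSubgroup.mem_sup.mpr
        ⟨⁅l, l'⁆, ⟨hXY _ hlX _ hlX', hLL _ hlL _ hlL'⟩, ⁅l, n'⁆ + ⁅n, l'⁆ + ⁅n, n'⁆, ?_, ?_⟩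
      · refine add_mem (add_mem (hLN _ hlL _ hn') ?_) (hNN _ hn _ hn')
        rw [← lie_skew]
        exact neg_mem (hLN _ hlL' _ hn)
      · simp only [add_lie, lie_add]
        abel
  exact key L hL

end BracketSolvable

/-! ### Comparison with solvable Lie algebras -/

section

variable {k M : Type*} [Field k] [LieRing M] [LieAlgebra k M]

theorem LieSubalgebra.bracketSolvable (L : LieSubalgebra k M) [LieAlgebra.IsSolvable L] :
    BracketSolvable L.toSubmodule.toAddSubgroup := by
  obtain ⟨n, hn⟩ := LieAlgebra.IsSolvable.solvable k L
  have key : ∀ m, m ≤ n → BracketSolvable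
      (((LieAlgebra.derivedSeries k L (n - m)).toSubmodule.toAddSubgroup).map
        (L.subtype : L →+ M)) := by
    intro m
    induction m with
    | zero =>
      intro _
      rw [Nat.sub_zero, hn]
      refine BracketSolvable.bot.mono ?_
      rintro _ ⟨x, hx, rfl⟩
      have : x = 0 := by simpa using hx
      simp [this]
    | succ m ih =>
      intro hm
      refine BracketSolvable.step _ _ (ih (by omega)) ?_
      rintro _ ⟨x, hx, rfl⟩ _ ⟨y, hy, rfl⟩
      refine ⟨⁅x, y⁆, ?_, rfl⟩
      have h1 : n - m = (n - (m + 1)) + 1 := by omega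
      change ⁅x, y⁆ ∈ LieAlgebra.derivedSeries k L (n - m)
      rw [h1, LieAlgebra.derivedSeries_def, LieAlgebra.derivedSeriesOfIdeal_succ]
      exact LieSubmodule.lie_mem_lie hx hy
  refine (key n le_rfl).mono fun x hx => ⟨⟨x, hx⟩, ?_, rfl⟩
  simp [LieAlgebra.derivedSeries_def]

theorem LieSubalgebra.isSolvable_of_bracketSolvable (L : LieSubalgebra k M)
    (h : BracketSolvable L.toSubmodule.toAddSubgroup) : LieAlgebra.IsSolvable L := by
  have key : ∀ X : AddSubgroup M, BracketSolvable X → ∀ m,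
      (∀ x ∈ LieAlgebra.derivedSeries k L m, (x : M) ∈ X) → LieAlgebra.IsSolvable L := by
    intro X hX
    induction hX with
    | bot =>
      intro m hm
      refine LieAlgebra.IsSolvable.mk (R := k) (k := m) ?_
      refine (LieSubmodule.eq_bot_iff _).mpr fun x hx => ?_
      have : (x : M) = 0 := hm x hx
      simpa using this
    | step X Y _ hXY ih =>
      intro m hm
      refine ih (m + 1) fun x hx => ?_
      rw [LieAlgebra.derivedSeries_def, LieAlgebra.derivedSeriesOfIdeal_succ,
        ← LieSubmodule.mem_toSubmodule, LieSubmodule.lieIdeal_oper_eq_linear_span'] at hx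
      induction hx using Submodule.closure_induction with
      | zero => exact zero_mem Y
      | add a b _ _ ha hb => exact add_mem ha hb
      -- `Y` is only an additive subgroup; the scalar is moved into the first entry, since derived
      -- terms are `k`-stable.
      | smul_mem r a ha =>
        obtain ⟨x, hx, y, hy, rfl⟩ := ha
        have := hXY _ (hm _ (SMulMemClass.smul_mem r hx)) _ (hm y hy)
        simpa using this
  exact key _ h 0 fun x _ => x.2

/-- In a solvable Lie algebra, a proper subspace `N` admits an ideal `I` not contained in `N`
with `⁅I, I⁆ ⊆ N`. -/
theorem LieAlgebra.exists_ideal_lie_mem {L : Type*} [LieRing L] [LieAlgebra k L]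
    [LieAlgebra.IsSolvable L] (N : Submodule k L) (hN : N ≠ ⊤) :
    ∃ I : LieIdeal k L, ¬ I.toSubmodule ≤ N ∧ ∀ x ∈ I, ∀ y ∈ I, ⁅x, y⁆ ∈ N := by
  classical
  have hex : ∃ n, (LieAlgebra.derivedSeries k L n).toSubmodule ≤ N := by
    obtain ⟨n, hn⟩ := LieAlgebra.IsSolvable.solvable k L
    exact ⟨n, by simp [hn]⟩
  have h0 : Nat.find hex ≠ 0 := by
    intro h
    have := Nat.find_spec hex
    rw [h] at this
    exact hN (top_le_iff.mp (by simpa [LieAlgebra.derivedSeries_def] using this))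
  obtain ⟨m, hm⟩ := Nat.exists_eq_succ_of_ne_zero h0
  refine ⟨LieAlgebra.derivedSeries k L m, Nat.find_min hex (by omega), fun x hx y hy => ?_⟩
  have := Nat.find_spec hex
  rw [hm] at this
  refine this ?_
  change ⁅x, y⁆ ∈ LieAlgebra.derivedSeries k L (m + 1)
  rw [LieAlgebra.derivedSeries_def, LieAlgebra.derivedSeriesOfIdeal_succ]
  exact LieSubmodule.lie_mem_lie hx hy

end

/-! ### Absorption by maximality and the intersection of `L` with a line -/

section

variable {F R : Type*} [Field F] [Field R] [Algebra F R]

theorem Derivation.lie_smul_right (x D : Derivation F R R) (r : R) :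
    ⁅x, r • D⁆ = x r • D + r • ⁅x, D⁆ := by
  ext z
  simp [Derivation.commutator_apply]
  ring

theorem Derivation.smul_lie_left (x D : Derivation F R R) (r : R) :
    ⁅r • D, x⁆ = r • ⁅D, x⁆ - x r • D := by
  ext z
  simp [Derivation.commutator_apply]
  ring

theorem mem_kerMultiples_one {D E : Derivation F R R} :
    E ∈ kerMultiples D 1 ↔ ∃ f : R, D f = 0 ∧ E = f • D := by
  change (∃ f : R, D f = 0 ∧ E = (f * 1) • D) ↔ _
  simp only [mul_one]

theorem mem_kerMultiples {D E : Derivation F R R} {b : R} :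
    E ∈ kerMultiples D b ↔ ∃ f : R, D f = 0 ∧ E = (f * b) • D := Iff.rfl

/-- `L` is maximal among the solvable subalgebras contained in `R L`. -/
def IsMaximalSolvableInSpan (L : LieSubalgebra F (Derivation F R R)) : Prop :=
  ∀ M : LieSubalgebra F (Derivation F R R), L ≤ M →
    (∀ x ∈ M, x ∈ Submodule.span R (L : Set (Derivation F R R))) →
    LieAlgebra.IsSolvable M → M ≤ L

variable {L : LieSubalgebra F (Derivation F R R)}

/-- A maximal solvable `L` absorbs every solvable subspace of `R L` normalized by `L`. -/
theorem IsMaximalSolvableInSpan.le_of_normalized (hmax : IsMaximalSolvableInSpan L)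
    [LieAlgebra.IsSolvable L] (N : Submodule F (Derivation F R R))
    (hLN : ∀ x ∈ L, ∀ y ∈ N, ⁅x, y⁆ ∈ N) (hNN : ∀ x ∈ N, ∀ y ∈ N, ⁅x, y⁆ ∈ N)
    (hN : BracketSolvable N.toAddSubgroup)
    (hspan : ∀ x ∈ N, x ∈ Submodule.span R (L : Set (Derivation F R R))) :
    ∀ x ∈ N, x ∈ L := by
  let M : LieSubalgebra F (Derivation F R R) :=
    { L.toSubmodule ⊔ N with
      lie_mem' := by
        intro x y hx hy
        obtain ⟨l, hl, n, hn, rfl⟩ := Submodule.mem_sup.mp hx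
        obtain ⟨l', hl', n', hn', rfl⟩ := Submodule.mem_sup.mp hy
        refine Submodule.mem_sup.mpr ⟨⁅l, l'⁆, L.lie_mem hl hl', ⁅l, n'⁆ + ⁅n, l'⁆ + ⁅n, n'⁆, ?_, ?_⟩
        · refine add_mem (add_mem (hLN _ hl _ hn') ?_) (hNN _ hn _ hn')
          rw [← lie_skew]
          exact neg_mem (hLN _ hl' _ hn)
        · simp only [add_lie, lie_add]
          abel }
  have hML : M ≤ L := by
    refine hmax M (fun x hx => (le_sup_left : L.toSubmodule ≤ _) hx) ?_ ?_
    · intro x hx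
      obtain ⟨l, hl, n, hn, rfl⟩ := Submodule.mem_sup.mp (show x ∈ L.toSubmodule ⊔ N from hx)
      exact add_mem (Submodule.subset_span hl) (hspan n hn)
    · refine M.isSolvable_of_bracketSolvable ?_
      refine (BracketSolvable.sup L.bracketSolvable hN (fun x hx y hy => L.lie_mem hx hy)
        hLN hNN).mono fun x hx => ?_
      obtain ⟨l, hl, n, hn, rfl⟩ := Submodule.mem_sup.mp (show x ∈ L.toSubmodule ⊔ N from hx)
      exact AddSubgroup.mem_sup.mpr ⟨l, hl, n, hn, rfl⟩
  exact fun x hx => hML ((le_sup_right : N ≤ L.toSubmodule ⊔ N) hx)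

/-- `D` spans over its field of constants a space normalized by `L`. -/
def NormalizesKerMultiples (L : LieSubalgebra F (Derivation F R R)) (D : Derivation F R R) : Prop :=
  ∀ x ∈ L, ∃ f : R, D f = 0 ∧ ⁅x, D⁆ = f • D

/-- Evaluating `⁅x, D⁆ = g D` at `f` leaves only `D (x f)`. Thus `L` acts on `F₁ = ker D`. -/
theorem NormalizesKerMultiples.apply_apply {D : Derivation F R R}
    (hn : NormalizesKerMultiples L D) {x : Derivation F R R} (hx : x ∈ L) {f : R} (hf : D f = 0) :
    D (x f) = 0 := by
  obtain ⟨g, -, hg⟩ := hn x hx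
  have := congrArg (fun E : Derivation F R R => E f) hg
  simpa [Derivation.commutator_apply, hf] using this

/-- `F₁ D` is abelian and normalized by `L`, so it is absorbed. -/
theorem IsMaximalSolvableInSpan.kerMultiples_one_le (hmax : IsMaximalSolvableInSpan L)
    [LieAlgebra.IsSolvable L] {D : Derivation F R R} (hD : D ∈ L)
    (hn : NormalizesKerMultiples L D) {f : R} (hf : D f = 0) : f • D ∈ L := by
  have hab : ∀ x ∈ kerMultiples D 1, ∀ y ∈ kerMultiples D 1, ⁅x, y⁆ = 0 := by
    intro x hx y hy
    obtain ⟨f, hf, rfl⟩ := mem_kerMultiples_one.mp hx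
    obtain ⟨g, hg, rfl⟩ := mem_kerMultiples_one.mp hy
    rw [Derivation.lie_smul_right, Derivation.smul_lie_left]
    simp [hf, hg]
  refine hmax.le_of_normalized (kerMultiples D 1) ?_ ?_ ?_ ?_ _
    (mem_kerMultiples_one.mpr ⟨f, hf, rfl⟩)
  · intro x hx y hy
    obtain ⟨f, hf, rfl⟩ := mem_kerMultiples_one.mp hy
    obtain ⟨g, hg, hxD⟩ := hn x hx
    refine mem_kerMultiples_one.mpr ⟨x f + f * g, ?_, ?_⟩
    · simp [hn.apply_apply hx hf, hf, hg]
    · rw [Derivation.lie_smul_right, hxD, smul_smul, ← add_smul]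
  · intro x hx y hy
    rw [hab x hx y hy]
    exact zero_mem _
  · exact BracketSolvable.of_abelian hab
  · intro x hx
    obtain ⟨f, hf, rfl⟩ := mem_kerMultiples_one.mp hx
    exact Submodule.smul_mem _ _ (Submodule.subset_span hD)

theorem mem_kerMultiples_one_sup {D E : Derivation F R R} {b : R} :
    E ∈ kerMultiples D 1 ⊔ kerMultiples D b ↔
      ∃ f g : R, D f = 0 ∧ D g = 0 ∧ E = (f + g * b) • D := by
  constructor
  · intro h
    obtain ⟨x, hx, y, hy, rfl⟩ := Submodule.mem_sup.mp h
    obtain ⟨f, hf, rfl⟩ := mem_kerMultiples_one.mp hx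
    obtain ⟨g, hg, rfl⟩ := mem_kerMultiples.mp hy
    exact ⟨f, g, hf, hg, (add_smul _ _ _).symm⟩
  · rintro ⟨f, g, hf, hg, rfl⟩
    rw [add_smul]
    exact Submodule.add_mem_sup (mem_kerMultiples_one.mpr ⟨f, hf, rfl⟩)
      (mem_kerMultiples.mpr ⟨g, hg, rfl⟩)

/-- `⁅f D + g b D, f' D + g' b D⁆ = (f g' - g f') D` if `D f = D g = D f' = D g' = 0`, `D b = 1`. -/
theorem lie_kerMultiples {D : Derivation F R R} {b f g f' g' : R} (hb : D b = 1)
    (hf : D f = 0) (hg : D g = 0) (hf' : D f' = 0) (hg' : D g' = 0) :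
    ⁅(f + g * b) • D, (f' + g' * b) • D⁆ = (f * g' - g * f') • D := by
  rw [Derivation.lie_smul_right, Derivation.smul_lie_left]
  ext z
  simp [hf, hg, hf', hg', hb]
  ring

/-- The intersection of a maximal solvable `L` with `R D` is `F₁ D` or `F₁ D + F₁ b D`. -/
theorem IsMaximalSolvableInSpan.smul_mem_dichotomy (hmax : IsMaximalSolvableInSpan L)
    [LieAlgebra.IsSolvable L] {D : Derivation F R R} (hD : D ∈ L) (hD0 : D ≠ 0)
    (hn : NormalizesKerMultiples L D) :
    (∀ r : R, r • D ∈ L → D r = 0) ∨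
      ∃ b : R, D b = 1 ∧ ∀ f : R, D f = 0 → (f * b) • D ∈ L := by
  -- `⁅r D, D⁆ = -(D r) D` has its coefficient in `ker D`.
  have hDr : ∀ r : R, r • D ∈ L → D (D r) = 0 := by
    intro r hr
    obtain ⟨f, hf, hrf⟩ := hn _ hr
    rw [Derivation.smul_lie_left, lie_self, smul_zero, zero_sub, ← neg_smul] at hrf
    have h := smul_left_injective R hD0 hrf
    rw [← neg_neg (D r), h]
    simp [hf]
  by_cases hsmall : ∀ r : R, r • D ∈ L → D r = 0
  · exact Or.inl hsmall
  right
  push Not at hsmall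
  obtain ⟨r, hrL, hr0⟩ := hsmall
  have hrr := hDr r hrL
  have hb : D (r / D r) = 1 := by
    rw [div_eq_mul_inv, Derivation.leibniz, Derivation.leibniz_inv, hrr]
    simp [hr0]
  set b := r / D r with hbdef
  have hr : r = D r * b := by rw [hbdef]; field_simp
  refine ⟨b, hb, ?_⟩
  have hmem : ∀ s : R, s • D ∈ L → s • D ∈ kerMultiples D 1 ⊔ kerMultiples D b := by
    intro s hs
    refine mem_kerMultiples_one_sup.mpr ⟨s - D s * b, D s, ?_, hDr s hs, ?_⟩
    · simp [hb, hDr s hs]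
    · congr 1
      ring
  -- The coefficient of `⁅x, r D⁆ ∈ L ∩ R D` lies in `F₁ + F₁ b`; with `r = (D r) b` and `D r ∈ F₁`
  -- nonzero, it can be solved for `x b`.
  have hLb : ∀ x ∈ L, ∃ f g : R, D f = 0 ∧ D g = 0 ∧ x b = f + g * b := by
    intro x hx
    obtain ⟨g, hg, hxD⟩ := hn x hx
    have h1 : ⁅x, r • D⁆ ∈ L := L.lie_mem hx hrL
    rw [Derivation.lie_smul_right, hxD, smul_smul, ← add_smul] at h1
    obtain ⟨p, q, hp, hq, hpq⟩ := mem_kerMultiples_one_sup.mp (hmem _ h1)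
    have h2 := smul_left_injective R hD0 hpq
    have h3 : x r = D r * x b + b * x (D r) := by
      conv_lhs => rw [hr]
      simp
    have h4 := hn.apply_apply hx hrr
    have hinv : D (D r)⁻¹ = 0 := by rw [Derivation.leibniz_inv, hrr]; simp
    refine ⟨(D r)⁻¹ * p, (D r)⁻¹ * (q - x (D r) - D r * g), ?_, ?_, ?_⟩
    · simp [hp, hinv]
    · simp [hq, h4, hg, hrr, hinv]
    · change x r + r * g = p + q * b at h2
      have h5 : D r * x b = p + (q - x (D r) - D r * g) * b := by
        linear_combination h2 - h3 - g * hr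
      field_simp
      linear_combination h5
  have hNN : ∀ x ∈ kerMultiples D 1 ⊔ kerMultiples D b,
      ∀ y ∈ kerMultiples D 1 ⊔ kerMultiples D b, ⁅x, y⁆ ∈ kerMultiples D 1 := by
    intro x hx y hy
    obtain ⟨f, g, hf, hg, rfl⟩ := mem_kerMultiples_one_sup.mp hx
    obtain ⟨f', g', hf', hg', rfl⟩ := mem_kerMultiples_one_sup.mp hy
    rw [lie_kerMultiples hb hf hg hf' hg']
    exact mem_kerMultiples_one.mpr ⟨_, by simp [hf, hg, hf', hg'], rfl⟩
  intro f hf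
  refine hmax.le_of_normalized (kerMultiples D 1 ⊔ kerMultiples D b) ?_ ?_ ?_ ?_ _
    (mem_kerMultiples_one_sup.mpr ⟨0, f, by simp, hf, by rw [zero_add]⟩)
  · intro x hx y hy
    obtain ⟨f, g, hf, hg, rfl⟩ := mem_kerMultiples_one_sup.mp hy
    obtain ⟨p, q, hp, hq, hpq⟩ := hLb x hx
    obtain ⟨h, hh, hxD⟩ := hn x hx
    refine mem_kerMultiples_one_sup.mpr
      ⟨x f + g * p + f * h, g * q + x g + g * h, ?_, ?_, ?_⟩
    · simp [hn.apply_apply hx hf, hf, hg, hp, hh]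
    · simp [hn.apply_apply hx hg, hg, hq, hh]
    · rw [Derivation.lie_smul_right, hxD, smul_smul, ← add_smul]
      congr 1
      simp [hpq]
      ring
  · intro x hx y hy
    exact (le_sup_left : _ ≤ kerMultiples D 1 ⊔ kerMultiples D b) (hNN x hx y hy)
  · refine BracketSolvable.step _ (kerMultiples D 1).toAddSubgroup ?_ hNN
    refine BracketSolvable.of_abelian fun x hx y hy => ?_
    obtain ⟨f, hf, rfl⟩ := mem_kerMultiples_one.mp hx
    obtain ⟨g, hg, rfl⟩ := mem_kerMultiples_one.mp hy
    rw [Derivation.lie_smul_right, Derivation.smul_lie_left]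
    simp [hf, hg]
  · intro x hx
    obtain ⟨f, g, -, -, rfl⟩ := mem_kerMultiples_one_sup.mp hx
    exact Submodule.smul_mem _ _ (Submodule.subset_span hD)

end

/-! ### Complements of `R D₁ ∩ L` and semidirect sums -/

section

variable {F R : Type*} [Field F] [Field R] [Algebra F R]
variable {L : LieSubalgebra F (Derivation F R R)}

theorem linearIndependent_pair_of_not_smul {D₁ D₂ : Derivation F R R} (h₁ : D₁ ≠ 0)
    (h₂ : ∀ r : R, D₂ ≠ r • D₁) : LinearIndependent R ![D₁, D₂] := by
  rw [LinearIndependent.pair_iff]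
  intro s t hst
  have ht : t = 0 := by
    by_contra ht
    refine h₂ (-(t⁻¹ * s)) ?_
    have : t⁻¹ • (s • D₁ + t • D₂) = 0 := by rw [hst, smul_zero]
    rw [smul_add, smul_smul, smul_smul, inv_mul_cancel₀ ht, one_smul] at this
    rw [neg_smul]
    exact eq_neg_of_add_eq_zero_right this
  subst ht
  rw [zero_smul, add_zero] at hst
  exact ⟨(smul_eq_zero.mp hst).resolve_right h₁, rfl⟩

theorem LinearIndependent.pair_coeff {M : Type*} [AddCommGroup M] [Module R M] {x y : M}
    (h : LinearIndependent R ![x, y]) {s t s' t' : R}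
    (e : s • x + t • y = s' • x + t' • y) : s = s' ∧ t = t' := by
  rw [LinearIndependent.pair_iff] at h
  have := h (s - s') (t - t') (by rw [← sub_eq_zero.mpr e]; module)
  exact ⟨sub_eq_zero.mp this.1, sub_eq_zero.mp this.2⟩

theorem exists_combination_of_finrank_eq_two
    (hrank : Module.finrank R (Submodule.span R (L : Set (Derivation F R R))) = 2)
    {D₁ D₂ : Derivation F R R} (h₁ : D₁ ∈ L) (h₂ : D₂ ∈ L)
    (hli : LinearIndependent R ![D₁, D₂]) {x : Derivation F R R} (hx : x ∈ L) :
    ∃ u v : R, x = u • D₁ + v • D₂ := by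
  have hfin : Module.Finite R (Submodule.span R (L : Set (Derivation F R R))) :=
    Module.finite_of_finrank_pos (by omega)
  have hle : Submodule.span R (Set.range ![D₁, D₂]) ≤
      Submodule.span R (L : Set (Derivation F R R)) := by
    refine Submodule.span_le.mpr ?_
    rintro _ ⟨i, rfl⟩
    fin_cases i
    · exact Submodule.subset_span h₁
    · exact Submodule.subset_span h₂
  have heq := Submodule.eq_of_le_of_finrank_eq hle
    (by rw [hrank, finrank_span_eq_card hli, Fintype.card_fin])
  have hx' : x ∈ Submodule.span R (Set.range ![D₁, D₂]) := by
    rw [heq]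
    exact Submodule.subset_span hx
  rw [Matrix.range_cons, Matrix.range_cons, Matrix.range_empty, Set.union_empty,
    Set.singleton_union, Submodule.mem_span_pair] at hx'
  obtain ⟨u, v, h⟩ := hx'
  exact ⟨u, v, h.symm⟩

/-- `R D ∩ L`, as a subspace of `L`. -/
def multiplesIn (L : LieSubalgebra F (Derivation F R R)) (D : Derivation F R R) :
    Submodule F L where
  carrier := {x | ∃ r : R, (x : Derivation F R R) = r • D}
  add_mem' := by
    rintro x y ⟨r, hr⟩ ⟨s, hs⟩
    exact ⟨r + s, by simp [hr, hs, add_smul]⟩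
  zero_mem' := ⟨0, by simp⟩
  smul_mem' := by
    rintro t x ⟨r, hr⟩
    exact ⟨t • r, by simp [hr]⟩

/-- A complement of `R D₁ ∩ L` in `L` acts on `L / (R D₁ ∩ L)` with constant coefficients. -/
theorem exists_complement [LieAlgebra.IsSolvable L]
    (hconst : ∀ r : R, (∀ D ∈ L, D r = 0) → ∃ t : F, algebraMap F R t = r)
    (hrank : Module.finrank R (Submodule.span R (L : Set (Derivation F R R))) = 2)
    {D₁ : Derivation F R R} (h₁ : D₁ ∈ L) (h₁0 : D₁ ≠ 0) (hn : NormalizesKerMultiples L D₁) :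
    ∃ D₂ ∈ L, LinearIndependent R ![D₁, D₂] ∧
      (∀ r : R, D₁ r = 0 → D₂ r = 0 → ∃ t : F, algebraMap F R t = r) ∧
      ∀ x ∈ L, ∃ u v : R, x = u • D₁ + v • D₂ ∧ D₁ v = 0 ∧ D₁ (D₁ u) = 0 ∧
        ∃ t : F, D₂ v = algebraMap F R t := by
  have hN : multiplesIn L D₁ ≠ ⊤ := by
    intro h
    have hle : Submodule.span R (L : Set (Derivation F R R)) ≤ Submodule.span R {D₁} := by
      refine Submodule.span_le.mpr fun x hx => ?_
      have : (⟨x, hx⟩ : L) ∈ multiplesIn L D₁ := h ▸ Submodule.mem_top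
      obtain ⟨r, hr⟩ := this
      exact Submodule.mem_span_singleton.mpr ⟨r, hr.symm⟩
    have := Submodule.finrank_mono hle
    rw [hrank, finrank_span_singleton h₁0] at this
    omega
  obtain ⟨I, hIN, hII⟩ := LieAlgebra.exists_ideal_lie_mem _ hN
  obtain ⟨D₂, hD₂I, hD₂N⟩ := Set.not_subset.mp hIN
  have hli : LinearIndependent R ![D₁, (D₂ : Derivation F R R)] :=
    linearIndependent_pair_of_not_smul h₁0 fun r hr => hD₂N ⟨r, hr⟩
  have hcomb := fun {x : Derivation F R R} (hx : x ∈ L) =>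
    exists_combination_of_finrank_eq_two hrank h₁ D₂.2 hli hx
  have hc : ∀ r : R, D₁ r = 0 → (D₂ : Derivation F R R) r = 0 →
      ∃ t : F, algebraMap F R t = r := by
    intro r hr₁ hr₂
    refine hconst r fun D hD => ?_
    obtain ⟨u, v, rfl⟩ := hcomb hD
    simp [hr₁, hr₂]
  obtain ⟨a, ha, haD⟩ := hn _ D₂.2
  refine ⟨D₂, D₂.2, hli, hc, fun x hx => ?_⟩
  obtain ⟨u, v, rfl⟩ := hcomb hx
  obtain ⟨f, hf, hfD⟩ := hn _ hx
  have h1 : ⁅u • D₁ + v • (D₂ : Derivation F R R), D₁⁆ =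
      (v * a - D₁ u) • D₁ + (-D₁ v) • (D₂ : Derivation F R R) := by
    rw [add_lie, Derivation.smul_lie_left, Derivation.smul_lie_left, lie_self, haD]
    module
  -- Comparing coefficients in `⁅x, D₁⁆ = f D₁` yields `D₁ v = 0` and `D₁ u = v a - f ∈ ker D₁`.
  obtain ⟨h2, h3⟩ := hli.pair_coeff
    (show (v * a - D₁ u) • D₁ + (-D₁ v) • (D₂ : Derivation F R R) = f • D₁ + (0 : R) • D₂ by
      rw [← h1, hfD, zero_smul, add_zero])
  have hv : D₁ v = 0 := neg_eq_zero.mp h3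
  have hu : D₁ (D₁ u) = 0 := by
    have : D₁ u = v * a - f := by linear_combination -h2
    simp [this, hv, ha, hf]
  refine ⟨u, v, rfl, hv, hu, ?_⟩
  have hlie : ⁅(D₂ : Derivation F R R), u • D₁ + v • (D₂ : Derivation F R R)⁆ =
      ((D₂ : Derivation F R R) u + u * a) • D₁ +
        ((D₂ : Derivation F R R) v) • (D₂ : Derivation F R R) := by
    rw [lie_add, Derivation.lie_smul_right, Derivation.lie_smul_right, lie_self, haD]
    module
  have hI : ⁅D₂, (⟨_, hx⟩ : L)⁆ ∈ I := by
    rw [← lie_skew]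
    exact neg_mem (I.lie_mem hD₂I)
  -- `⁅D₂, ⁅D₂, x⁆⁆` lies in `R D₁`, so its `D₂`-coefficient `D₂ (D₂ v)` vanishes. As also `D₁ (D₂
  -- v) = 0`, the element `D₂ v` is a constant.
  obtain ⟨q, hq⟩ := hII D₂ hD₂I _ hI
  have hq' : ⁅(D₂ : Derivation F R R), ⁅(D₂ : Derivation F R R),
      u • D₁ + v • (D₂ : Derivation F R R)⁆⁆ = q • D₁ := hq
  rw [hlie, lie_add, Derivation.lie_smul_right, Derivation.lie_smul_right, lie_self, haD] at hq'
  have hz := (hli.pair_coeff (show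
    ((D₂ : Derivation F R R) ((D₂ : Derivation F R R) u + u * a) +
      ((D₂ : Derivation F R R) u + u * a) * a) • D₁ +
      ((D₂ : Derivation F R R) ((D₂ : Derivation F R R) v)) • (D₂ : Derivation F R R) =
      q • D₁ + (0 : R) • (D₂ : Derivation F R R) by rw [zero_smul, add_zero, ← hq']; module)).2
  obtain ⟨t, ht⟩ := hc _ (hn.apply_apply D₂.2 hv) hz
  exact ⟨t, ht.symm⟩

theorem lie_combination {M : Type*} [LieRing M] [LieAlgebra F M] {x y : M} (h : ⁅x, y⁆ = -y)
    (s t s' t' : F) : ⁅s • x + t • y, s' • x + t' • y⁆ = (t * s' - s * t') • y := by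
  have h' : ⁅y, x⁆ = y := by rw [← lie_skew, h, neg_neg]
  simp only [add_lie, lie_add, smul_lie, lie_smul, lie_self, h, h']
  module

theorem isSemidirectSum_of_one {D₁ D₂ : Derivation F R R} (h₂ : D₂ ∈ L)
    (hli : LinearIndependent R ![D₁, D₂]) (hn : NormalizesKerMultiples L D₁)
    (N : Submodule F (Derivation F R R))
    (hN : ∀ x, x ∈ N ↔ x ∈ L ∧ ∃ r : R, x = r • D₁)
    (hL : ∀ x ∈ L, ∃ (u : R) (t : F), x = u • D₁ + t • D₂) :
    IsSemidirectSum L.toSubmodule (Submodule.span F {D₂}) N where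
  lie_mem_subalgebra := by
    intro x hx y hy
    obtain ⟨s, rfl⟩ := Submodule.mem_span_singleton.mp hx
    obtain ⟨t, rfl⟩ := Submodule.mem_span_singleton.mp hy
    simp
  lie_mem_ideal := by
    intro x hx y hy
    obtain ⟨hyL, r, rfl⟩ := (hN y).mp hy
    obtain ⟨f, -, hf⟩ := hn x hx
    refine (hN _).mpr ⟨L.lie_mem hx hyL, x r + r * f, ?_⟩
    rw [Derivation.lie_smul_right, hf, smul_smul, ← add_smul]
  sup_eq := by
    apply le_antisymm
    · refine sup_le ?_ fun x hx => ((hN x).mp hx).1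
      rw [Submodule.span_le, Set.singleton_subset_iff]
      exact h₂
    · intro x hx
      obtain ⟨u, t, rfl⟩ := hL x hx
      rw [add_comm]
      refine Submodule.add_mem_sup (Submodule.smul_mem _ _ (Submodule.mem_span_singleton_self _))
        ((hN _).mpr ⟨?_, u, rfl⟩)
      have := sub_mem hx (L.smul_mem t h₂)
      rwa [add_sub_cancel_right] at this
  inf_eq := by
    rw [eq_bot_iff]
    rintro x ⟨hx, hxN⟩
    obtain ⟨t, rfl⟩ := Submodule.mem_span_singleton.mp hx
    obtain ⟨-, r, hr⟩ := (hN _).mp hxN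
    have := (hli.pair_coeff (show (0 : R) • D₁ + (algebraMap F R t) • D₂ = r • D₁ + (0 : R) • D₂ by
      rw [algebraMap_smul, hr]; module)).2
    rw [Submodule.mem_bot, ← algebraMap_smul R t D₂, this, zero_smul]

/-- The relation `h32` makes the span of the two elements a subalgebra with ideal `⟨D₂⟩`; `N = L ∩ R
D₁` is an ideal because `L` normalizes the line `R D₁`. -/
theorem isSemidirectSum_of_two {D₁ D₂ : Derivation F R R} {c d : R} (h₂ : D₂ ∈ L)
    (h₃ : c • D₁ + d • D₂ ∈ L) (hli : LinearIndependent R ![D₁, D₂])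
    (hd : D₂ d = 1) (h32 : ⁅c • D₁ + d • D₂, D₂⁆ = -D₂)
    (hn : NormalizesKerMultiples L D₁) (N : Submodule F (Derivation F R R))
    (hN : ∀ x, x ∈ N ↔ x ∈ L ∧ ∃ r : R, x = r • D₁)
    (hL : ∀ x ∈ L, ∃ (u : R) (s t : F), x = u • D₁ + s • (c • D₁ + d • D₂) + t • D₂) :
    ∃ B : Submodule F (Derivation F R R),
      IsSemidirectSum B (Submodule.span F {c • D₁ + d • D₂}) (Submodule.span F {D₂}) ∧
      IsSemidirectSum L.toSubmodule B N := by
  -- Applying `D₂` to the coefficient equation `s d + t = 0` gives `s = 0`, hence `t = 0`.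
  have hind : ∀ (s t : F) (r : R), s • (c • D₁ + d • D₂) + t • D₂ = r • D₁ → s = 0 ∧ t = 0 := by
    intro s t r h
    have h1 := (hli.pair_coeff (show (algebraMap F R s * c) • D₁ +
      (algebraMap F R s * d + algebraMap F R t) • D₂ = r • D₁ + (0 : R) • D₂ by
        rw [zero_smul, add_zero, ← h, ← algebraMap_smul R s, ← algebraMap_smul R t]; module)).2
    have h2 := congrArg D₂ h1
    simp [hd] at h2
    subst h2
    simpa using h1
  have hB : ∀ x, x ∈ Submodule.span F {c • D₁ + d • D₂} ⊔ Submodule.span F {D₂} ↔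
      ∃ s t : F, x = s • (c • D₁ + d • D₂) + t • D₂ := by
    intro x
    rw [Submodule.mem_sup]
    constructor
    · rintro ⟨y, hy, z, hz, rfl⟩
      obtain ⟨s, rfl⟩ := Submodule.mem_span_singleton.mp hy
      obtain ⟨t, rfl⟩ := Submodule.mem_span_singleton.mp hz
      exact ⟨s, t, rfl⟩
    · rintro ⟨s, t, rfl⟩
      exact ⟨_, Submodule.smul_mem _ _ (Submodule.mem_span_singleton_self _), _,
        Submodule.smul_mem _ _ (Submodule.mem_span_singleton_self _), rfl⟩
  have h23 : ⁅D₂, c • D₁ + d • D₂⁆ = D₂ := by rw [← lie_skew, h32, neg_neg]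
  refine ⟨Submodule.span F {c • D₁ + d • D₂} ⊔ Submodule.span F {D₂}, ⟨?_, ?_, rfl, ?_⟩,
    ⟨?_, ?_, ?_, ?_⟩⟩
  · intro x hx y hy
    obtain ⟨s, rfl⟩ := Submodule.mem_span_singleton.mp hx
    obtain ⟨t, rfl⟩ := Submodule.mem_span_singleton.mp hy
    rw [smul_lie, lie_smul, lie_self, smul_zero, smul_zero]
    exact zero_mem _
  · intro x hx y hy
    obtain ⟨s, t, rfl⟩ := (hB x).mp hx
    obtain ⟨r, rfl⟩ := Submodule.mem_span_singleton.mp hy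
    rw [lie_smul, add_lie, smul_lie, smul_lie, lie_self, h32, smul_zero, add_zero]
    exact Submodule.smul_mem _ _ (Submodule.smul_mem _ _
      (neg_mem (Submodule.mem_span_singleton_self _)))
  · rw [eq_bot_iff]
    rintro x ⟨hx, hy⟩
    obtain ⟨s, rfl⟩ := Submodule.mem_span_singleton.mp hx
    obtain ⟨t, ht⟩ := Submodule.mem_span_singleton.mp hy
    have := (hind s (-t) 0 (by rw [← ht]; module)).1
    simp [this]
  · intro x hx y hy
    obtain ⟨s, t, rfl⟩ := (hB x).mp hx
    obtain ⟨s', t', rfl⟩ := (hB y).mp hy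
    refine (hB _).mpr ⟨0, t * s' - s * t', ?_⟩
    rw [lie_combination h32]
    module
  · intro x hx y hy
    obtain ⟨hyL, r, rfl⟩ := (hN y).mp hy
    obtain ⟨f, -, hf⟩ := hn x hx
    refine (hN _).mpr ⟨L.lie_mem hx hyL, x r + r * f, ?_⟩
    rw [Derivation.lie_smul_right, hf, smul_smul, ← add_smul]
  · apply le_antisymm
    · refine sup_le ?_ fun x hx => ((hN x).mp hx).1
      intro x hx
      obtain ⟨s, t, rfl⟩ := (hB x).mp hx
      exact add_mem (L.smul_mem s h₃) (L.smul_mem t h₂)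
    · intro x hx
      obtain ⟨u, s, t, rfl⟩ := hL x hx
      rw [add_assoc, add_comm (u • D₁)]
      refine Submodule.add_mem_sup ((hB _).mpr ⟨s, t, rfl⟩) ((hN _).mpr ⟨?_, u, rfl⟩)
      have := sub_mem hx (add_mem (L.smul_mem s h₃) (L.smul_mem t h₂))
      rwa [add_assoc, add_sub_cancel_right] at this
  · rw [eq_bot_iff]
    rintro x ⟨hx, hxN⟩
    obtain ⟨s, t, rfl⟩ := (hB x).mp hx
    obtain ⟨-, r, hr⟩ := (hN _).mp hxN
    obtain ⟨rfl, rfl⟩ := hind s t r hr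
    simp

end

/-! ### Types 1–4 -/

section

variable {F R : Type*} [Field F] [Field R] [Algebra F R]
variable {L : LieSubalgebra F (Derivation F R R)}

/-- The possible shapes of `L` modulo `R D₁ ∩ L`: dimension one or two over `F`. -/
theorem dimension_dichotomy {D₁ D₂ : Derivation F R R}
    (hc : ∀ r : R, D₁ r = 0 → D₂ r = 0 → ∃ t : F, algebraMap F R t = r)
    (hL : ∀ x ∈ L, ∃ u v : R, x = u • D₁ + v • D₂ ∧ D₁ v = 0 ∧ D₁ (D₁ u) = 0 ∧
        ∃ t : F, D₂ v = algebraMap F R t) :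
    (∀ x ∈ L, ∃ (u : R) (t : F), x = u • D₁ + t • D₂) ∨
    ∃ c d : R, c • D₁ + d • D₂ ∈ L ∧ D₂ d = 1 ∧ D₁ d = 0 ∧ D₁ (D₁ c) = 0 ∧
      ∀ x ∈ L, ∃ (u : R) (s t : F), x = u • D₁ + s • (c • D₁ + d • D₂) + t • D₂ := by
  by_cases hV : ∀ u v : R, u • D₁ + v • D₂ ∈ L → D₁ v = 0 → D₁ (D₁ u) = 0 →
      (∃ t : F, D₂ v = algebraMap F R t) → D₂ v = 0
  · left
    intro x hx
    obtain ⟨u, v, rfl, hv, hu, ht⟩ := hL x hx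
    obtain ⟨t, rfl⟩ := hc v hv (hV u v hx hv hu ht)
    exact ⟨u, t, by rw [algebraMap_smul]⟩
  right
  push Not at hV
  obtain ⟨u, v, hx₀, hv, hu, ⟨t, ht⟩, ht₀⟩ := hV
  obtain ⟨c, d, hx, hd, hd₁, hcc⟩ : ∃ c d : R, c • D₁ + d • D₂ ∈ L ∧ D₂ d = 1 ∧ D₁ d = 0 ∧
      D₁ (D₁ c) = 0 := by
    rw [ht] at ht₀
    refine ⟨t⁻¹ • u, t⁻¹ • v, ?_, ?_, ?_, ?_⟩
    · have := L.smul_mem t⁻¹ hx₀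
      rwa [smul_add, ← smul_assoc, ← smul_assoc] at this
    · rw [Derivation.map_smul, ht, Algebra.smul_def, map_inv₀, inv_mul_cancel₀ ht₀]
    · simp [hv]
    · simp [hu]
  refine ⟨c, d, hx, hd, hd₁, hcc, fun x hx => ?_⟩
  obtain ⟨u, v, rfl, hv, hu, s, hs⟩ := hL x hx
  -- `v` and `s d` have the same images under `D₁` and `D₂`, so they differ by a constant.
  obtain ⟨t, ht⟩ := hc (v - algebraMap F R s * d) (by simp [hv, hd₁]) (by simp [hs, hd])
  refine ⟨u - algebraMap F R s * c, s, t, ?_⟩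
  rw [← algebraMap_smul R s, ← algebraMap_smul R t, ht]
  module

/-- If `L` normalizes `F₁ D₁` for some `D₁ ∈ L`, then `L` is of one of the first four types. -/
theorem exists_type_of_normalizes [LieAlgebra.IsSolvable L] (hmax : IsMaximalSolvableInSpan L)
    (hconst : ∀ r : R, (∀ D ∈ L, D r = 0) → ∃ t : F, algebraMap F R t = r)
    (hrank : Module.finrank R (Submodule.span R (L : Set (Derivation F R R))) = 2)
    {D₁ : Derivation F R R} (h₁ : D₁ ∈ L) (h₁0 : D₁ ≠ 0) (hn : NormalizesKerMultiples L D₁) :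
    ∃ D₂ ∈ L, ∃ a : R, LinearIndependent R ![D₁, D₂] ∧ D₁ a = 0 ∧ ⁅D₂, D₁⁆ = a • D₁ ∧
      (IsType1 L D₁ D₂ ∨ IsType2 L D₁ D₂ a ∨ IsType3 L D₁ D₂ a ∨ IsType4 L D₁ D₂ a) := by
  obtain ⟨D₂, h₂, hli, hc, hL⟩ := exists_complement hconst hrank h₁ h₁0 hn
  obtain ⟨a, ha, ha₂⟩ := hn D₂ h₂
  have hF₁ : ∀ {f : R}, D₁ f = 0 → f • D₁ ∈ L := fun hf => hmax.kerMultiples_one_le h₁ hn hf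
  have hli' : ∀ g : R, LinearIndependent R ![D₁, D₂ + g • D₁] := fun g =>
    linearIndependent_pair_of_not_smul h₁0 fun r hr => by
      have := (hli.pair_coeff (show (g - r) • D₁ + (1 : R) • D₂ = (0 : R) • D₁ + (0 : R) • D₂ by
        rw [zero_smul, zero_smul, add_zero, ← sub_eq_zero.mpr hr]
        module)).2
      exact one_ne_zero this
  rcases hmax.smul_mem_dichotomy h₁ h₁0 hn with hsmall | ⟨b, hb, hbL⟩
  · have hN : ∀ x, x ∈ kerMultiples D₁ 1 ↔ x ∈ L ∧ ∃ r : R, x = r • D₁ := by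
      intro x
      rw [mem_kerMultiples_one]
      constructor
      · rintro ⟨f, hf, rfl⟩
        exact ⟨hF₁ hf, f, rfl⟩
      · rintro ⟨hx, r, rfl⟩
        exact ⟨r, hsmall r hx, rfl⟩
    rcases dimension_dichotomy hc hL with h1 | ⟨c, d, hx, hd, hd₁, hcc, h2⟩
    · exact ⟨D₂, h₂, a, hli, ha, ha₂, Or.inl (isSemidirectSum_of_one h₂ hli hn _ hN h1)⟩
    have hlie : ⁅c • D₁ + d • D₂, D₂⁆ = (-(D₂ c + a * c)) • D₁ - D₂ := by
      rw [add_lie, Derivation.smul_lie_left, Derivation.smul_lie_left, lie_self, hd,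
        ← lie_skew, ha₂]
      module
    have hr : D₁ (D₂ c + a * c) = 0 := by
      have h3 := add_mem (L.lie_mem hx h₂) h₂
      rw [hlie, sub_add_cancel] at h3
      have := hsmall _ h3
      rwa [map_neg, neg_eq_zero] at this
    -- With `r = D₂ c + a c`, the bracket is `-D₂ - r D₁`; the term `r D₁` has to be removed. If `D₁
    -- c = 0`, then `c D₁ ∈ L` can be subtracted, so `c = 0` may be taken.
    by_cases he : D₁ c = 0
    · have h₃ : (0 : R) • D₁ + d • D₂ ∈ L := by
        have := sub_mem hx (hF₁ he)
        rwa [add_sub_cancel_left, ← zero_add (d • D₂), ← zero_smul R D₁] at this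
      refine ⟨D₂, h₂, a, hli, ha, ha₂, Or.inr (Or.inr (Or.inl ⟨0, d, 0, hd₁, by simp, hd, by simp,
        by simp, isSemidirectSum_of_two h₂ h₃ hli hd ?_ hn _ hN fun x hx => ?_⟩))⟩
      · rw [zero_smul, zero_add, Derivation.smul_lie_left, lie_self, hd]
        module
      · obtain ⟨u, s, t, rfl⟩ := h2 x hx
        refine ⟨u + algebraMap F R s * c, s, t, ?_⟩
        rw [← algebraMap_smul R s, ← algebraMap_smul R s]
        module
    · set r := D₂ c + a * c with hrdef
      have hg : D₁ (-(r / D₁ c)) = 0 := by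
        rw [div_eq_mul_inv]
        simp [Derivation.leibniz_inv, hr, hcc]
      -- Replacing `D₂` by `D₂ + g D₁` keeps `a` and changes `r` to `r + g D₁ c`; this `g` makes it
      -- zero.
      set g := -(r / D₁ c) with hgdef
      have hgr : r + g * D₁ c = 0 := by
        rw [hgdef]
        field_simp
        ring
      have h₂' : D₂ + g • D₁ ∈ L := add_mem h₂ (hF₁ hg)
      have h₃ : c • D₁ + d • (D₂ + g • D₁) ∈ L := by
        have := add_mem hx (hF₁ (show D₁ (d * g) = 0 by simp [hd₁, hg]))
        rwa [add_assoc, mul_smul, ← smul_add] at this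
      have ha₂' : ⁅D₂ + g • D₁, D₁⁆ = a • D₁ := by
        rw [add_lie, ha₂, Derivation.smul_lie_left, lie_self, hg]
        simp
      have hd' : (D₂ + g • D₁) d = 1 := by simp [hd, hd₁]
      have hc' : (D₂ + g • D₁) c = -(a * c) := by
        simp only [Derivation.add_apply, Derivation.smul_apply, smul_eq_mul]
        linear_combination hgr
      refine ⟨D₂ + g • D₁, h₂', a, hli' g, ha, ha₂', Or.inr (Or.inr (Or.inl ⟨c, d, 0, hd₁, hcc, hd',
        by simp, by rw [hc', add_zero], isSemidirectSum_of_two h₂' h₃ (hli' g) hd' ?_ hn _ hN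
        fun x hx => ?_⟩))⟩
      · rw [add_lie, Derivation.smul_lie_left, Derivation.smul_lie_left, lie_self, hd', hc',
          ← lie_skew, ha₂']
        module
      · obtain ⟨u, s, t, rfl⟩ := h2 x hx
        refine ⟨u - algebraMap F R s * d * g - algebraMap F R t * g, s, t, ?_⟩
        rw [← algebraMap_smul R s, ← algebraMap_smul R t, ← algebraMap_smul R s,
          ← algebraMap_smul R t]
        module
  · have hN : ∀ x, x ∈ kerMultiples D₁ 1 ⊔ kerMultiples D₁ b ↔ x ∈ L ∧ ∃ r : R, x = r • D₁ := by
      intro x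
      rw [mem_kerMultiples_one_sup]
      constructor
      · rintro ⟨f, g, hf, hg, rfl⟩
        refine ⟨?_, _, rfl⟩
        rw [add_smul]
        exact add_mem (hF₁ hf) (hbL g hg)
      · rintro ⟨hx, r, rfl⟩
        obtain ⟨f, hf, hrf⟩ := hn _ hx
        rw [Derivation.smul_lie_left, lie_self, smul_zero, zero_sub, ← neg_smul] at hrf
        have h := smul_left_injective R h₁0 hrf
        have hrr : D₁ (D₁ r) = 0 := by
          rw [← neg_neg (D₁ r), h]
          simp [hf]
        refine ⟨r - D₁ r * b, D₁ r, ?_, hrr, ?_⟩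
        · simp [hb, hrr]
        · rw [sub_add_cancel]
    -- As `a b D₁ ∈ L`, this correction makes the complement commute with `D₁`: types 2 and 4 are
    -- reached with `a = 0`.
    set E := D₂ + (a * b) • D₁ with hE
    have hEL : E ∈ L := add_mem h₂ (hbL a ha)
    have hEli : LinearIndependent R ![D₁, E] := hli' _
    have hE₁ : ⁅E, D₁⁆ = (0 : R) • D₁ := by
      rw [hE, add_lie, ha₂, Derivation.smul_lie_left, lie_self]
      simp [ha, hb]
    have hEb : D₁ (E b) = 0 := by
      have := congrArg (fun X : Derivation F R R => X b) hE₁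
      simpa [Derivation.commutator_apply, hb] using this
    rcases dimension_dichotomy hc hL with h1 | ⟨c, d, hx, hd, hd₁, hcc, h2⟩
    · refine ⟨E, hEL, 0, hEli, by simp, hE₁, Or.inr (Or.inl ⟨b, E b, hb, hEb, by simp,
        isSemidirectSum_of_one hEL hEli hn _ hN fun x hx => ?_⟩)⟩
      obtain ⟨u, t, rfl⟩ := h1 x hx
      refine ⟨u - algebraMap F R t * (a * b), t, ?_⟩
      rw [hE, ← algebraMap_smul R t, ← algebraMap_smul R t]
      module
    · have hEd : E d = 1 := by simp [hE, hd, hd₁]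
      have hmem : ∀ f g : R, D₁ f = 0 → D₁ g = 0 → (f + g * b) • D₁ ∈ L := fun f g hf hg =>
        ((hN _).mp (mem_kerMultiples_one_sup.mpr ⟨f, g, hf, hg, rfl⟩)).1
      have h₃ : (0 : R) • D₁ + d • E ∈ L := by
        -- The two arguments are the `F₁`-components of `d a b - c`; adding this multiple of `D₁`
        -- turns `c D₁ + d D₂` into `d E`.
        have h4 := hmem (-(c - D₁ c * b)) (d * a - D₁ c) (by simp [hcc, hb])
          (by simp [hcc, hd₁, ha])
        convert add_mem hx h4 using 1
        rw [hE]
        module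
      refine ⟨E, hEL, 0, hEli, by simp, hE₁, Or.inr (Or.inr (Or.inr ⟨b, 0, d, 0, E b, hb, hEd, hd₁,
        by simp, by simp, hEb, by simp, by simp, isSemidirectSum_of_two hEL h₃ hEli hEd ?_ hn _ hN
        fun x hx => ?_⟩))⟩
      · rw [zero_smul, zero_add, Derivation.smul_lie_left, lie_self, hEd]
        module
      · obtain ⟨u, s, t, rfl⟩ := h2 x hx
        refine ⟨u + algebraMap F R s * c - algebraMap F R s * d * (a * b)
          - algebraMap F R t * (a * b), s, t, ?_⟩
        rw [hE, ← algebraMap_smul R s, ← algebraMap_smul R t, ← algebraMap_smul R s,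
          ← algebraMap_smul R t]
        module

end

/-! ### Type 5: affine representations -/

section

attribute [local instance] LieRing.ofAssociativeRing

variable {F R : Type*} [Field F] [Field R] [Algebra F R]

/-- `sl₂` is perfect when 2 is invertible, so every term of a chain would contain it. All multiples
`c` are carried along because the terms are only additive subgroups. -/
theorem not_bracketSolvable_of_sl2 [CharZero F] (X : AddSubgroup (Matrix (Fin 3) (Fin 3) F))
    (he : ∀ c : F, !![0, c, 0; 0, 0, 0; 0, 0, 0] ∈ X)
    (hf : ∀ c : F, !![0, 0, 0; c, 0, 0; 0, 0, 0] ∈ X)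
    (hh : ∀ c : F, !![c, 0, 0; 0, -c, 0; 0, 0, 0] ∈ X) : ¬ BracketSolvable X := by
  intro hX
  induction hX with
  | bot =>
    have := congrFun (congrFun ((AddSubgroup.mem_bot).mp (he 1)) 0) 1
    exact one_ne_zero this
  | step X Y _ hXY ih =>
    refine ih (fun c => ?_) (fun c => ?_) (fun c => ?_)
    · convert hXY _ (hh (c / 2)) _ (he 1) using 1
      ext i j
      fin_cases i <;> fin_cases j <;> simp [Ring.lie_def]
    · convert hXY _ (hh (-(c / 2))) _ (hf 1) using 1
      ext i j
      fin_cases i <;> fin_cases j <;> simp [Ring.lie_def]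
    · convert hXY _ (he c) _ (hf 1) using 1
      ext i j
      fin_cases i <;> fin_cases j <;> simp [Ring.lie_def]

theorem finrank_affineLieAlgebra_le : Module.finrank F (affineLieAlgebra F) ≤ 6 := by
  let f : affineLieAlgebra F →ₗ[F] (Fin 2 → Fin 3 → F) :=
    { toFun := fun M i j => (M : Matrix (Fin 3) (Fin 3) F) i.castSucc j
      map_add' := fun _ _ => rfl
      map_smul' := fun _ _ => rfl }
  have hf : Function.Injective f := by
    intro M N h
    ext i j
    refine Fin.lastCases ?_ (fun i => congrFun (congrFun h i) j) i
    exact (M.2 j).trans (N.2 j).symm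
  have := LinearMap.finrank_le_finrank_of_injective hf
  simpa [Module.finrank_pi_fintype] using this

theorem finrank_le_five_of_isSolvable [CharZero F]
    (S : LieSubalgebra F (Matrix (Fin 3) (Fin 3) F)) (hS : S ≤ affineLieAlgebra F)
    [LieAlgebra.IsSolvable S] : Module.finrank F S ≤ 5 := by
  by_contra h
  have h6 : Module.finrank F (affineLieAlgebra F).toSubmodule ≤ Module.finrank F S.toSubmodule :=
    finrank_affineLieAlgebra_le.trans (by change 6 ≤ Module.finrank F S; omega)
  have heq : S.toSubmodule = (affineLieAlgebra F).toSubmodule :=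
    Submodule.eq_of_le_of_finrank_le hS h6
  have hmem : ∀ M : Matrix (Fin 3) (Fin 3) F, (∀ j, M 2 j = 0) → M ∈ S.toSubmodule.toAddSubgroup :=
    fun M hM => by
      change M ∈ S.toSubmodule
      rw [heq]
      exact hM
  refine not_bracketSolvable_of_sl2 S.toSubmodule.toAddSubgroup (fun c => hmem _ fun j => ?_)
    (fun c => hmem _ fun j => ?_) (fun c => hmem _ fun j => ?_) S.bracketSolvable
  all_goals fin_cases j <;> rfl

variable {L : LieSubalgebra F (Derivation F R R)}

/-- The `F`-linear coordinate functions of `L` in a frame `D₁, D₂`. -/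
theorem exists_coordinates {D₁ D₂ : Derivation F R R} (hli : LinearIndependent R ![D₁, D₂])
    (hL : ∀ x ∈ L, ∃ u v : R, x = u • D₁ + v • D₂) :
    ∃ u v : L →ₗ[F] R, ∀ x : L, (x : Derivation F R R) = u x • D₁ + v x • D₂ := by
  choose u v huv using fun x : L => hL x x.2
  have huniq : ∀ {x : L} {s t : R}, (x : Derivation F R R) = s • D₁ + t • D₂ →
      u x = s ∧ v x = t := fun {x} _ _ h => hli.pair_coeff ((huv x).symm.trans h)
  have hadd : ∀ x y : L, u (x + y) = u x + u y ∧ v (x + y) = v x + v y := fun x y =>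
    huniq (by
      change (x : Derivation F R R) + y = _
      rw [huv x, huv y]
      module)
  have hsmul : ∀ (t : F) (x : L), u (t • x) = t • u x ∧ v (t • x) = t • v x := fun t x =>
    huniq (by
      change t • (x : Derivation F R R) = _
      rw [huv x, smul_add, smul_assoc, smul_assoc])
  exact ⟨⟨⟨u, fun x y => (hadd x y).1⟩, fun t x => (hsmul t x).1⟩,
    ⟨⟨v, fun x y => (hadd x y).2⟩, fun t x => (hsmul t x).2⟩, huv⟩

theorem lie_neg_affine (a b c d e f a' b' c' d' e' f' : F) :
    ⁅-!![a, b, c; d, e, f; 0, 0, 0], -!![a', b', c'; d', e', f'; 0, 0, 0]⁆ =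
      -!![a * a' + d * b' - (a' * a + d' * b),
        b * a' + e * b' - (b' * a + e' * b),
        c * a' + f * b' - (c' * a + f' * b);
        a * d' + d * e' - (a' * d + d' * e),
        b * d' + e * e' - (b' * d + e' * e),
        c * d' + f * e' - (c' * d + f' * e); 0, 0, 0] := by
  rw [Ring.lie_def]
  ext i j
  fin_cases i <;> fin_cases j <;> simp <;> ring

/-- A retraction `ρ` onto `F` is not multiplicative, but it is `F`-linear, and one factor of each
product is in `F`. -/
theorem map_affine_combination (ρ : R →ₗ[F] F) (hρ : ∀ t : F, ρ (algebraMap F R t) = t)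
    {a b c d a' b' c' d' : R} (hb : ∃ t : F, b = algebraMap F R t)
    (hd : ∃ t : F, d = algebraMap F R t) (hb' : ∃ t : F, b' = algebraMap F R t)
    (hd' : ∃ t : F, d' = algebraMap F R t) :
    ρ (a * b + c * d - (a' * b' + c' * d')) =
      ρ a * ρ b + ρ c * ρ d - (ρ a' * ρ b' + ρ c' * ρ d') := by
  have hρm : ∀ {r s : R}, (∃ t : F, s = algebraMap F R t) → ρ (r * s) = ρ r * ρ s := by
    rintro r _ ⟨t, rfl⟩
    rw [mul_comm, ← Algebra.smul_def, map_smul, hρ, smul_eq_mul, mul_comm]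
  rw [map_sub, map_add, map_add, hρm hb, hρm hd, hρm hb', hρm hd']

theorem map_derivation_affine_combination (ρ : R →ₗ[F] F)
    (hρ : ∀ t : F, ρ (algebraMap F R t) = t) (D : Derivation F R R)
    {a b c d a' b' c' d' : R} (hb : ∃ t : F, b = algebraMap F R t)
    (hd : ∃ t : F, d = algebraMap F R t) (hb' : ∃ t : F, b' = algebraMap F R t)
    (hd' : ∃ t : F, d' = algebraMap F R t) :
    ρ (D (a * b + c * d - (a' * b' + c' * d'))) =
      ρ (D a) * ρ b + ρ (D c) * ρ d - (ρ (D a') * ρ b' + ρ (D c') * ρ d') := by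
  rw [← map_affine_combination ρ hρ hb hd hb' hd']
  obtain ⟨b, rfl⟩ := hb
  obtain ⟨d, rfl⟩ := hd
  obtain ⟨b', rfl⟩ := hb'
  obtain ⟨d', rfl⟩ := hd'
  congr 1
  simp [mul_comm]

/-- Derivations that are "affine" in a commuting frame `D₁, D₂` form a Lie algebra of affine
transformations. -/
theorem exists_affine_representation {D₁ D₂ : Derivation F R R}
    (hli : LinearIndependent R ![D₁, D₂]) (h12 : ⁅D₁, D₂⁆ = 0) (u v : L →ₗ[F] R)
    (huv : ∀ x : L, (x : Derivation F R R) = u x • D₁ + v x • D₂)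
    (hu₁ : ∀ x, ∃ t : F, D₁ (u x) = algebraMap F R t)
    (hu₂ : ∀ x, ∃ t : F, D₂ (u x) = algebraMap F R t)
    (hv₁ : ∀ x, ∃ t : F, D₁ (v x) = algebraMap F R t)
    (hv₂ : ∀ x, ∃ t : F, D₂ (v x) = algebraMap F R t)
    (ρ : R →ₗ[F] F) (hρ : ∀ t : F, ρ (algebraMap F R t) = t) :
    ∃ φ : L →ₗ⁅F⁆ Matrix (Fin 3) (Fin 3) F, ∀ x, φ x = -!![ρ (D₁ (u x)), ρ (D₂ (u x)), ρ (u x);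
        ρ (D₁ (v x)), ρ (D₂ (v x)), ρ (v x); 0, 0, 0] := by
  have h21 : ⁅D₂, D₁⁆ = 0 := by rw [← lie_skew, h12, neg_zero]
  -- In a commuting frame, each product in the coefficients of `⁅x, y⁆` contains a derivative of a
  -- coefficient, which lies in `F`.
  have key : ∀ x y : L,
      u ⁅x, y⁆ = u x * D₁ (u y) + v x * D₂ (u y) - (u y * D₁ (u x) + v y * D₂ (u x)) ∧
      v ⁅x, y⁆ = u x * D₁ (v y) + v x * D₂ (v y) - (u y * D₁ (v x) + v y * D₂ (v x)) := by
    intro x y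
    refine hli.pair_coeff ?_
    rw [← huv, LieSubalgebra.coe_bracket, huv x, huv y]
    simp only [add_lie, lie_add, Derivation.lie_smul_right, Derivation.smul_lie_left, lie_self,
        h12, h21, Derivation.smul_apply, smul_eq_mul]
    module
  have e := fun {a b c d a' b' c' d' : R} =>
    map_affine_combination ρ hρ (a := a) (b := b) (c := c) (d := d) (a' := a') (b' := b')
      (c' := c') (d' := d')
  have e' := fun (D : Derivation F R R) {a b c d a' b' c' d' : R} =>
    map_derivation_affine_combination ρ hρ D (a := a) (b := b) (c := c) (d := d) (a' := a')
      (b' := b') (c' := c') (d' := d')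
  -- The bracket of affine vector fields is the opposite of the matrix commutator; the minus sign
  -- repairs this.
  let f : L →ₗ[F] Matrix (Fin 3) (Fin 3) F :=
    { toFun := fun x => -!![ρ (D₁ (u x)), ρ (D₂ (u x)), ρ (u x);
        ρ (D₁ (v x)), ρ (D₂ (v x)), ρ (v x); 0, 0, 0]
      map_add' := fun x y => by
        ext i j
        fin_cases i <;> fin_cases j <;> simp [add_comm]
      map_smul' := fun t x => by
        ext i j
        fin_cases i <;> fin_cases j <;> simp }
  refine ⟨{ f with map_lie' := ?_ }, fun x => rfl⟩
  intro x y
  have hu := fun D : Derivation F R R => (congrArg (fun r => ρ (D r)) (key x y).1).trans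
    (e' D (hu₁ y) (hu₂ y) (hu₁ x) (hu₂ x))
  have hv := fun D : Derivation F R R => (congrArg (fun r => ρ (D r)) (key x y).2).trans
    (e' D (hv₁ y) (hv₂ y) (hv₁ x) (hv₂ x))
  have hu₀ := (congrArg ρ (key x y).1).trans (e (hu₁ y) (hu₂ y) (hu₁ x) (hu₂ x))
  have hv₀ := (congrArg ρ (key x y).2).trans (e (hv₁ y) (hv₂ y) (hv₁ x) (hv₂ x))
  change -!![ρ (D₁ (u ⁅x, y⁆)), ρ (D₂ (u ⁅x, y⁆)), ρ (u ⁅x, y⁆);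
    ρ (D₁ (v ⁅x, y⁆)), ρ (D₂ (v ⁅x, y⁆)), ρ (v ⁅x, y⁆); 0, 0, 0] =
    ⁅-!![ρ (D₁ (u x)), ρ (D₂ (u x)), ρ (u x); ρ (D₁ (v x)), ρ (D₂ (v x)), ρ (v x); 0, 0, 0],
      -!![ρ (D₁ (u y)), ρ (D₂ (u y)), ρ (u y); ρ (D₁ (v y)), ρ (D₂ (v y)), ρ (v y); 0, 0, 0]⁆
  rw [lie_neg_affine, show ρ (D₁ (u ⁅x, y⁆)) = _ from hu D₁,
    show ρ (D₂ (u ⁅x, y⁆)) = _ from hu D₂, show ρ (D₁ (v ⁅x, y⁆)) = _ from hv D₁,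
    show ρ (D₂ (v ⁅x, y⁆)) = _ from hv D₂, hu₀, hv₀]

/-- A solvable `L` of derivations that are "affine" in a commuting frame `D₁, D₂ ∈ L` embeds into
`ga₂(F)`, with `F D₁ + F D₂` going to the translations. -/
theorem isType5_of_affine [CharZero F] [LieAlgebra.IsSolvable L] {D₁ D₂ : Derivation F R R}
    (h₁ : D₁ ∈ L) (h₂ : D₂ ∈ L) (hli : LinearIndependent R ![D₁, D₂]) (h12 : ⁅D₁, D₂⁆ = 0)
    (hc : ∀ r : R, D₁ r = 0 → D₂ r = 0 → ∃ t : F, algebraMap F R t = r)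
    (hcomb : ∀ x ∈ L, ∃ u v : R, x = u • D₁ + v • D₂)
    (haff : ∀ u v : R, u • D₁ + v • D₂ ∈ L →
      (∃ t : F, D₁ u = algebraMap F R t) ∧ (∃ t : F, D₂ u = algebraMap F R t) ∧
      (∃ t : F, D₁ v = algebraMap F R t) ∧ ∃ t : F, D₂ v = algebraMap F R t) :
    IsType5 L := by
  obtain ⟨u, v, huv⟩ := exists_coordinates hli hcomb
  have haff' : ∀ x : L, (∃ t : F, D₁ (u x) = algebraMap F R t) ∧
      (∃ t : F, D₂ (u x) = algebraMap F R t) ∧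
      (∃ t : F, D₁ (v x) = algebraMap F R t) ∧ ∃ t : F, D₂ (v x) = algebraMap F R t :=
    fun x => haff _ _ (huv x ▸ x.2)
  -- A linear retraction `R → F` replaces evaluation at a point.
  obtain ⟨ρ, hρ⟩ := LinearMap.exists_leftInverse_of_injective (Algebra.linearMap F R)
    (LinearMap.ker_eq_bot.mpr (algebraMap F R).injective)
  replace hρ : ∀ t : F, ρ (algebraMap F R t) = t := fun t => LinearMap.congr_fun hρ t
  have hz : ∀ {r : R}, (∃ t : F, r = algebraMap F R t) → ρ r = 0 → r = 0 := by
    rintro _ ⟨t, rfl⟩ h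
    rw [hρ] at h
    rw [h, map_zero]
  obtain ⟨φ, hφ⟩ := exists_affine_representation hli h12 u v huv (fun x => (haff' x).1)
    (fun x => (haff' x).2.1) (fun x => (haff' x).2.2.1) (fun x => (haff' x).2.2.2) ρ hρ
  have hinj : Function.Injective φ := by
    rw [injective_iff_map_eq_zero]
    intro x h
    rw [hφ, neg_eq_zero] at h
    have hφ' := fun i j => congrFun (congrFun h i) j
    obtain ⟨x1, x2, x3, x4⟩ := haff' x
    -- Vanishing derivatives make the coefficient a constant, and `ρ` detects constants.
    have hu : u x = 0 := by
      obtain ⟨t, ht⟩ := hc (u x) (hz x1 (hφ' 0 0)) (hz x2 (hφ' 0 1))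
      exact hz ⟨t, ht.symm⟩ (hφ' 0 2)
    have hv : v x = 0 := by
      obtain ⟨t, ht⟩ := hc (v x) (hz x3 (hφ' 1 0)) (hz x4 (hφ' 1 1))
      exact hz ⟨t, ht.symm⟩ (hφ' 1 2)
    exact Subtype.ext (by simp [huv x, hu, hv])
  have hsolv : LieAlgebra.IsSolvable φ.range := inferInstance
  have hle : φ.range ≤ affineLieAlgebra F := by
    rintro _ ⟨x, rfl⟩ j
    change φ x 2 j = 0
    rw [hφ]
    fin_cases j <;> simp
  let ψ : L ≃ₗ⁅F⁆ φ.range := LieEquiv.ofInjective φ hinj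
  let τ : F → F → L := fun s t =>
    ⟨s • D₁ + t • D₂, add_mem (L.smul_mem s h₁) (L.smul_mem t h₂)⟩
  have hτ : ∀ s t : F, u (τ s t) = algebraMap F R s ∧ v (τ s t) = algebraMap F R t := fun s t =>
    hli.pair_coeff (by
      rw [← huv, algebraMap_smul, algebraMap_smul])
  have hfin : Module.Finite F L := Module.Finite.equiv ψ.symm.toLinearEquiv
  refine ⟨⟨φ.range, hle, hsolv, ?_, ⟨ψ⟩⟩, ?_, ?_⟩
  · rintro M ⟨hM2, hM⟩
    refine ⟨τ (-M 0 2) (-M 1 2), ?_⟩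
    change φ _ = M
    rw [hφ, (hτ _ _).1, (hτ _ _).2, hρ, hρ]
    ext i j
    fin_cases i <;> fin_cases j <;> simp [hM2, hM]
  · have hli₂ : LinearIndependent F ![(⟨D₁, h₁⟩ : L), ⟨D₂, h₂⟩] := by
      rw [LinearIndependent.pair_iff]
      intro s t hst
      have h : s • D₁ + t • D₂ = 0 := congrArg Subtype.val hst
      obtain ⟨hs, ht⟩ := hli.pair_coeff (show algebraMap F R s • D₁ + algebraMap F R t • D₂ =
        (0 : R) • D₁ + (0 : R) • D₂ by
          rw [algebraMap_smul, algebraMap_smul, h]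
          module)
      simpa using And.intro hs ht
    simpa using hli₂.fintype_card_le_finrank
  · rw [ψ.toLinearEquiv.finrank_eq]
    exact finrank_le_five_of_isSolvable _ hle

end

/-! ### The classification over the field of constants -/

section

variable {F R : Type*} [Field F] [Field R] [Algebra F R]
variable {L : LieSubalgebra F (Derivation F R R)}

/-- The classification for a Lie algebra `L` of `F`-derivations with field of constants `F`. -/
theorem IsMaximalSolvableInSpan.exists_type [CharZero F] [LieAlgebra.IsSolvable L]
    (hmax : IsMaximalSolvableInSpan L)
    (hconst : ∀ r : R, (∀ D ∈ L, D r = 0) → ∃ t : F, algebraMap F R t = r)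
    (hrank : Module.finrank R (Submodule.span R (L : Set (Derivation F R R))) = 2) :
    ∃ D₁ ∈ L, ∃ D₂ ∈ L, ∃ a : R, LinearIndependent R ![D₁, D₂] ∧ D₁ a = 0 ∧ ⁅D₂, D₁⁆ = a • D₁ ∧
      (IsType1 L D₁ D₂ ∨ IsType2 L D₁ D₂ a ∨ IsType3 L D₁ D₂ a ∨ IsType4 L D₁ D₂ a ∨
        IsType5 L) := by
  have hbot : (⊥ : Submodule F L) ≠ ⊤ := by
    intro h
    have : Submodule.span R (L : Set (Derivation F R R)) = ⊥ := by
      refine Submodule.span_eq_bot.mpr fun x hx => ?_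
      have : (⟨x, hx⟩ : L) ∈ (⊥ : Submodule F L) := h ▸ Submodule.mem_top
      exact congrArg Subtype.val ((Submodule.mem_bot F).mp this)
    rw [this, finrank_bot] at hrank
    omega
  obtain ⟨I, hI, hII⟩ := LieAlgebra.exists_ideal_lie_mem _ hbot
  have hab : ∀ x ∈ I, ∀ y ∈ I, ⁅(x : Derivation F R R), (y : Derivation F R R)⁆ = 0 :=
    fun x hx y hy => congrArg Subtype.val ((Submodule.mem_bot F).mp (hII x hx y hy))
  obtain ⟨D₁, hD₁I, hD₁0⟩ := Set.not_subset.mp hI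
  have h₁0 : (D₁ : Derivation F R R) ≠ 0 := fun h => hD₁0 (Subtype.ext h)
  by_cases hone : ∀ y ∈ I, ∃ f : R, (y : Derivation F R R) = f • (D₁ : Derivation F R R)
  · have hn : NormalizesKerMultiples L (D₁ : Derivation F R R) := by
      intro x hx
      have hmem : ⁅(⟨x, hx⟩ : L), D₁⁆ ∈ I := I.lie_mem hD₁I
      obtain ⟨f, hf⟩ := hone _ hmem
      have h0 := hab _ hD₁I _ hmem
      rw [hf, Derivation.lie_smul_right, lie_self, smul_zero, add_zero] at h0
      exact ⟨f, (smul_eq_zero.mp h0).resolve_right h₁0, hf⟩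
    obtain ⟨D₂, h₂, a, hli, ha, ha₂, h⟩ :=
      exists_type_of_normalizes hmax hconst hrank D₁.2 h₁0 hn
    exact ⟨D₁, D₁.2, D₂, h₂, a, hli, ha, ha₂, by tauto⟩
  push Not at hone
  obtain ⟨D₂, hD₂I, hD₂⟩ := hone
  obtain ⟨D₁, h₁⟩ := D₁
  obtain ⟨D₂, h₂⟩ := D₂
  have hli : LinearIndependent R ![D₁, D₂] := linearIndependent_pair_of_not_smul h₁0 hD₂
  have h12 : ⁅D₁, D₂⁆ = 0 := hab _ hD₁I _ hD₂I
  have h21 : ⁅D₂, D₁⁆ = 0 := hab _ hD₂I _ hD₁I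
  have hcomb : ∀ x ∈ L, ∃ u v : R, x = u • D₁ + v • D₂ := fun x hx =>
    exists_combination_of_finrank_eq_two hrank h₁ h₂ hli hx
  have hc : ∀ r : R, D₁ r = 0 → D₂ r = 0 → ∃ t : F, algebraMap F R t = r := by
    intro r hr₁ hr₂
    refine hconst r fun D hD => ?_
    obtain ⟨u, v, rfl⟩ := hcomb D hD
    simp [hr₁, hr₂]
  -- Commuting with `D₁` and `D₂` means that both derivations kill both coefficients.
  have hIc : ∀ x : L, x ∈ I → ∀ s t : R, (x : Derivation F R R) = s • D₁ + t • D₂ →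
      (∃ p : F, algebraMap F R p = s) ∧ ∃ q : F, algebraMap F R q = t := by
    intro x hx s t hst
    have e₁ := hab _ hD₁I _ hx
    have e₂ := hab _ hD₂I _ hx
    simp only [hst, lie_add, Derivation.lie_smul_right, lie_self, h12, h21, smul_zero,
      add_zero] at e₁ e₂
    rw [LinearIndependent.pair_iff] at hli
    obtain ⟨s₁, t₁⟩ := hli _ _ e₁
    obtain ⟨s₂, t₂⟩ := hli _ _ e₂
    exact ⟨hc s s₁ s₂, hc t t₁ t₂⟩
  refine ⟨D₁, h₁, D₂, h₂, 0, hli, by simp, by rw [h21, zero_smul],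
    Or.inr (Or.inr (Or.inr (Or.inr (isType5_of_affine h₁ h₂ hli h12 hc hcomb ?_))))⟩
  intro u v huv
  have key : ∀ (D : Derivation F R R) (hD : D ∈ L), (⟨D, hD⟩ : L) ∈ I → ⁅D₁, D⁆ = 0 →
      ⁅D₂, D⁆ = 0 → (∃ p : F, D u = algebraMap F R p) ∧ ∃ q : F, D v = algebraMap F R q := by
    intro D hD hDI e₁ e₂
    -- The bracket lies in `I` with coefficients `-D u` and `-D v`, which are therefore constants.
    obtain ⟨⟨p, hp⟩, q, hq⟩ := hIc ⁅(⟨_, huv⟩ : L), ⟨D, hD⟩⁆ (I.lie_mem hDI) (-D u) (-D v) (by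
      change ⁅u • D₁ + v • D₂, D⁆ = _
      rw [add_lie, Derivation.smul_lie_left, Derivation.smul_lie_left, e₁, e₂]
      module)
    exact ⟨⟨-p, by rw [map_neg, hp, neg_neg]⟩, -q, by rw [map_neg, hq, neg_neg]⟩
  obtain ⟨hu₁, hv₁⟩ := key D₁ h₁ hD₁I (lie_self _) h21
  obtain ⟨hu₂, hv₂⟩ := key D₂ h₂ hD₂I h12 (lie_self _)
  exact ⟨hu₁, hu₂, hv₁, hv₂⟩

end

/-! ### Change of scalars from `K` to the field of constants -/

section

variable {K R : Type*} [Field K] [Field R] [Algebra K R]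

/-- Constants are killed by `L`, so the bracket is `F`-bilinear on products of constants with
elements of `L`. -/
theorem lie_mem_span_constantField (L : LieSubalgebra K (Derivation K R R))
    {X Y : Set (Derivation K R R)} (hX : X ⊆ L) (hXY : ∀ x ∈ X, ∀ y ∈ X, ⁅x, y⁆ ∈ Y) :
    ∀ x ∈ Submodule.span (constantField L) X, ∀ y ∈ Submodule.span (constantField L) X,
      ⁅x, y⁆ ∈ Submodule.span (constantField L) Y := by
  intro x hx y hy
  induction hx using Submodule.closure_induction with
  | zero => simp
  | add a b _ _ ha hb => rw [add_lie]; exact add_mem ha hb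
  | smul_mem f D hD =>
    induction hy using Submodule.closure_induction with
    | zero => simp
    | add a b _ _ ha hb => rw [lie_add]; exact add_mem ha hb
    | smul_mem g E hE =>
      have h : ⁅f • D, g • E⁆ = f • g • ⁅D, E⁆ := by
        change ⁅(f : R) • D, (g : R) • E⁆ = (f : R) • (g : R) • ⁅D, E⁆
        rw [Derivation.lie_smul_right, Derivation.smul_lie_left, Derivation.smul_apply,
          f.2 E (hX hE), g.2 D (hX hD)]
        module
      rw [h]
      exact Submodule.smul_mem _ _ (Submodule.smul_mem _ _ (Submodule.subset_span (hXY _ hD _ hE)))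

/-- The `F`-span of `L`, with `F` the field of constants of `L`. -/
def constantSpan (L : LieSubalgebra K (Derivation K R R)) :
    LieSubalgebra K (Derivation K R R) where
  __ := (Submodule.span (constantField L) (L : Set (Derivation K R R))).restrictScalars K
  lie_mem' := fun {x y} hx hy => lie_mem_span_constantField L subset_rfl
    (fun _ hx _ hy => L.lie_mem hx hy) x hx y hy

/-- Intersecting a chain for `L` with `L` and taking `F`-spans gives a chain for `FL`. -/
theorem isSolvable_constantSpan (L : LieSubalgebra K (Derivation K R R))
    [LieAlgebra.IsSolvable L] : LieAlgebra.IsSolvable (constantSpan L) := by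
  refine (constantSpan L).isSolvable_of_bracketSolvable ?_
  have key : ∀ X : AddSubgroup (Derivation K R R), BracketSolvable X → BracketSolvable
      (Submodule.span (constantField L) ((X : Set (Derivation K R R)) ∩ (L : Set (Derivation K R R)))).toAddSubgroup := by
    intro X hX
    induction hX with
    | bot =>
      refine BracketSolvable.bot.mono ?_
      change Submodule.span (constantField L) _ ≤ ⊥
      rw [Submodule.span_le]
      exact fun x hx => hx.1
    | step X Y _ hXY ih =>
      exact BracketSolvable.step _ _ ih (lie_mem_span_constantField L Set.inter_subset_right
        fun x hx y hy => ⟨hXY x hx.1 y hy.1, L.lie_mem hx.2 hy.2⟩)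
  refine (key _ L.bracketSolvable).mono ?_
  exact Submodule.span_mono fun x hx => ⟨hx, hx⟩

theorem constantSpan_le_span (L : LieSubalgebra K (Derivation K R R)) {x : Derivation K R R}
    (hx : x ∈ constantSpan L) : x ∈ Submodule.span R (L : Set (Derivation K R R)) := by
  change x ∈ Submodule.span (constantField L) _ at hx
  induction hx using Submodule.span_induction with
  | mem x hx => exact Submodule.subset_span hx
  | zero => exact zero_mem _
  | add x y _ _ hx hy => exact add_mem hx hy
  | smul f x _ hx => exact Submodule.smul_mem _ (f : R) hx

theorem le_derivationsW_of_le_span {A : Type*} [CommRing A] [Algebra K A] [Algebra A R]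
    {L M : LieSubalgebra K (Derivation K R R)} (hL : L ≤ derivationsW K A R)
    (hM : ∀ x ∈ M, x ∈ Submodule.span R (L : Set (Derivation K R R))) :
    M ≤ derivationsW K A R := by
  intro x hx
  have h : Submodule.span R (L : Set (Derivation K R R)) ≤
      Submodule.span R {D : Derivation K R R | ∃ δ : Derivation K A A,
        ∀ x : A, D (algebraMap A R x) = algebraMap A R (δ x)} :=
    Submodule.span_le.mpr hL
  exact h (hM x hx)

theorem derivationRank_eq_of_le_span {L M : LieSubalgebra K (Derivation K R R)} (hLM : L ≤ M)
    (hM : ∀ x ∈ M, x ∈ Submodule.span R (L : Set (Derivation K R R))) :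
    derivationRank M = derivationRank L := by
  have : Submodule.span R (M : Set (Derivation K R R)) = Submodule.span R (L : Set _) :=
    le_antisymm (Submodule.span_le.mpr hM) (Submodule.span_mono hLM)
  rw [derivationRank, derivationRank, this]

/-- Restriction of scalars of derivations along an intermediate field. -/
def restrictScalarsDerivation (F : IntermediateField K R) :
    Derivation F R R →ₗ[R] Derivation K R R where
  toFun D := D.restrictScalars K
  map_add' _ _ := rfl
  map_smul' _ _ := rfl

@[simp]
theorem restrictScalarsDerivation_apply (F : IntermediateField K R) (D : Derivation F R R)
    (r : R) : restrictScalarsDerivation F D r = D r := rfl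

theorem restrictScalarsDerivation_injective (F : IntermediateField K R) :
    Function.Injective (restrictScalarsDerivation F) := fun D E h => by
  ext r
  exact congrArg (fun X : Derivation K R R => X r) h

theorem restrictScalarsDerivation_lie (F : IntermediateField K R) (D E : Derivation F R R) :
    restrictScalarsDerivation F ⁅D, E⁆ =
      ⁅restrictScalarsDerivation F D, restrictScalarsDerivation F E⁆ := by
  ext r
  simp [Derivation.commutator_apply]

/-- By Leibniz, a derivation killing the constants is linear over them. -/
theorem exists_restrictScalars_eq {L : LieSubalgebra K (Derivation K R R)} {D : Derivation K R R}
    (hD : D ∈ L) :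
    ∃ D' : Derivation (constantField L) R R, restrictScalarsDerivation (constantField L) D' = D :=
  ⟨Derivation.mk'
    { toFun := D
      map_add' := map_add D
      map_smul' := fun f r => by
        change D ((f : R) * r) = (f : R) * D r
        simp [f.2 D hD] }
    fun x y => by simp, by ext; rfl⟩

/-- A Lie algebra `L` of derivations that is closed under multiplication by its constants,
as a Lie algebra over its field of constants. -/
def overConstantField (L : LieSubalgebra K (Derivation K R R))
    (hL : ∀ f ∈ constantField L, ∀ D ∈ L, f • D ∈ L) :
    LieSubalgebra (constantField L) (Derivation (constantField L) R R) where
  carrier := {D | restrictScalarsDerivation (constantField L) D ∈ L}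
  add_mem' := fun hx hy => add_mem (S := LieSubalgebra K (Derivation K R R)) hx hy
  zero_mem' := zero_mem L
  smul_mem' := fun f _ hD => hL f f.2 _ hD
  lie_mem' := fun {x y} hx hy => by
    change restrictScalarsDerivation (constantField L) ⁅x, y⁆ ∈ L
    rw [restrictScalarsDerivation_lie]
    exact L.lie_mem hx hy

/-- The image under restriction of scalars of a Lie algebra of derivations. -/
def restrictScalarsLie {F : IntermediateField K R} (M : LieSubalgebra F (Derivation F R R)) :
    LieSubalgebra K (Derivation K R R) where
  carrier := restrictScalarsDerivation F '' M
  add_mem' := by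
    rintro _ _ ⟨x, hx, rfl⟩ ⟨y, hy, rfl⟩
    exact ⟨x + y, add_mem (S := LieSubalgebra F (Derivation F R R)) hx hy, map_add _ _ _⟩
  zero_mem' := ⟨0, zero_mem M, map_zero _⟩
  smul_mem' := by
    rintro t _ ⟨x, hx, rfl⟩
    refine ⟨algebraMap K F t • x, M.smul_mem _ hx, ?_⟩
    ext r
    simp
  lie_mem' := by
    rintro _ _ ⟨x, hx, rfl⟩ ⟨y, hy, rfl⟩
    exact ⟨⁅x, y⁆, M.lie_mem hx hy, restrictScalarsDerivation_lie F x y⟩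

theorem isSolvable_restrictScalarsLie {F : IntermediateField K R}
    (M : LieSubalgebra F (Derivation F R R)) [LieAlgebra.IsSolvable M] :
    LieAlgebra.IsSolvable (restrictScalarsLie M) :=
  (restrictScalarsLie M).isSolvable_of_bracketSolvable
    ((M.bracketSolvable.map (restrictScalarsDerivation F : _ →+ _)
      (restrictScalarsDerivation_lie F)).mono le_rfl)

theorem isSolvable_overConstantField (L : LieSubalgebra K (Derivation K R R))
    [LieAlgebra.IsSolvable L] (hL : ∀ f ∈ constantField L, ∀ D ∈ L, f • D ∈ L) :
    LieAlgebra.IsSolvable (overConstantField L hL) :=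
  (overConstantField L hL).isSolvable_of_bracketSolvable
    ((L.bracketSolvable.comap (restrictScalarsDerivation (constantField L) : _ →+ _)
      (restrictScalarsDerivation_lie _) (restrictScalarsDerivation_injective _)).mono le_rfl)

theorem map_span_overConstantField (L : LieSubalgebra K (Derivation K R R))
    (hL : ∀ f ∈ constantField L, ∀ D ∈ L, f • D ∈ L) :
    (Submodule.span R (overConstantField L hL : Set (Derivation (constantField L) R R))).map
      (restrictScalarsDerivation (constantField L)) =
      Submodule.span R (L : Set (Derivation K R R)) := by
  rw [Submodule.map_span]
  congr 1
  ext D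
  constructor
  · rintro ⟨D', hD', rfl⟩
    exact hD'
  · intro hD
    obtain ⟨D', rfl⟩ := exists_restrictScalars_eq (L := L) hD
    exact ⟨D', hD, rfl⟩

theorem finrank_span_overConstantField (L : LieSubalgebra K (Derivation K R R))
    (hL : ∀ f ∈ constantField L, ∀ D ∈ L, f • D ∈ L) :
    Module.finrank R (Submodule.span R
      (overConstantField L hL : Set (Derivation (constantField L) R R))) = derivationRank L := by
  rw [derivationRank, ← map_span_overConstantField L hL]
  exact (Submodule.equivMapOfInjective _ (restrictScalarsDerivation_injective _) _).finrank_eq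

end

/-! ### The main theorem -/

theorem mainTheorem4 {K A R : Type*} [Field K] [CharZero K] [CommRing A] [IsDomain A]
    [Algebra K A] [Field R] [Algebra A R] [IsFractionRing A R] [Algebra K R]
    [IsScalarTower K A R] (L : LieSubalgebra K (Derivation K R R))
    (hL : Maximal (fun M : LieSubalgebra K (Derivation K R R) =>
      M ≤ derivationsW K A R ∧ LieAlgebra.IsSolvable M ∧ derivationRank M = 2) L) :
    -- `L`, viewed as a set of `F`-linear derivations of `R`, is a Lie algebra over `F = F(L)`
    ∃ LF : LieSubalgebra (constantField L) (Derivation (constantField L) R R),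
      (∀ D : Derivation K R R, D ∈ L ↔ ∃ D' ∈ LF, D'.restrictScalars K = D) ∧
      ∃ D₁ ∈ LF, ∃ D₂ ∈ LF, ∃ a : R, LinearIndependent R ![D₁, D₂] ∧
        D₁ a = 0 ∧ ⁅D₂, D₁⁆ = a • D₁ ∧
        (IsType1 LF D₁ D₂ ∨ IsType2 LF D₁ D₂ a ∨ IsType3 LF D₁ D₂ a ∨ IsType4 LF D₁ D₂ a ∨
          IsType5 LF) := by
  obtain ⟨hW, hsol, hrank⟩ := hL.prop
  -- Enlarging `L` inside `RL` preserves both the rank and containment in `W(A)`, so only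
  -- solvability has to be checked.
  have hmax : ∀ M : LieSubalgebra K (Derivation K R R), L ≤ M →
      (∀ x ∈ M, x ∈ Submodule.span R (L : Set (Derivation K R R))) →
      LieAlgebra.IsSolvable M → M ≤ L := fun M hLM hM hMs =>
    hL.le_of_ge ⟨le_derivationsW_of_le_span hW hM, hMs,
      (derivationRank_eq_of_le_span hLM hM).trans hrank⟩ hLM
  have hF : ∀ f ∈ constantField L, ∀ D ∈ L, f • D ∈ L := by
    intro f hf D hD
    have hle : constantSpan L ≤ L := hmax _ (fun x hx => Submodule.subset_span hx)
      (fun x hx => constantSpan_le_span L hx) (isSolvable_constantSpan L)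
    exact hle (Submodule.smul_mem _ (⟨f, hf⟩ : constantField L) (Submodule.subset_span hD))
  have hsolF := isSolvable_overConstantField L hF
  have hlift : ∀ D ∈ L, ∃ D' ∈ overConstantField L hF,
      restrictScalarsDerivation (constantField L) D' = D := by
    intro D hD
    obtain ⟨D', rfl⟩ := exists_restrictScalars_eq hD
    exact ⟨D', hD, rfl⟩
  -- A competitor over `F` is also one over `K`, after restriction of scalars.
  have hmaxF : IsMaximalSolvableInSpan (overConstantField L hF) := by
    intro M hLM hM hMs x hx
    refine hmax (restrictScalarsLie M) ?_ ?_ (isSolvable_restrictScalarsLie M) ⟨x, hx, rfl⟩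
    · intro D hD
      obtain ⟨D', hD', rfl⟩ := hlift D hD
      exact ⟨D', hLM hD', rfl⟩
    · rintro _ ⟨y, hy, rfl⟩
      rw [← map_span_overConstantField L hF]
      exact Submodule.mem_map_of_mem (hM y hy)
  refine ⟨overConstantField L hF, fun D => ⟨hlift D, ?_⟩, hmaxF.exists_type ?_
    ((finrank_span_overConstantField L hF).trans hrank)⟩
  · rintro ⟨D', hD', rfl⟩
    exact hD'
  · intro r hr
    refine ⟨⟨r, fun D hD => ?_⟩, rfl⟩
    obtain ⟨D', hD', rfl⟩ := hlift D hD
    exact hr D' hD'
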